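/- Fix integers $K\ge 1$, $r\ge 0$, an index $k_*\in\{1,\dots,K\}$, quantile levels $\tau_1,\dots,\tau_K\in(0,1)$, weights $w_1,\dots,w_K>0$ and sets $\mathcal A,\mathcal F\subset\mathbb R^r$. For a parameter $\theta=(\Lambda_1,\dots,\Lambda_K,F)$ with $\Lambda_k=[\lambda_{k,1},\dots,\lambda_{k,N}]'\in\mathbb R^{N\times r}$ and $F=[f_1,\dots,f_T]'\in\mathbb R^{T\times r}$, and data $X_{it}$ ($i\le N$, $t\le T$), let $$M_{NT}(\theta)=\frac1{NT}\sum_{k=1}^K\sum_{i=1}^N\sum_{t=1}^T w_k\,\rho_{\tau_k}(X_{it}-\lambda_{k,i}'f_t),\qquad \rho_\tau(e)=(\tau-\mathbf 1\{e\le 0\})\,e .$$ Let $\Theta^r=\Theta^r_{NT}$ be the set of all $\theta$ such that $\lambda_{k,i}\in\mathcal A$ and $f_t\in\mathcal F$ for all $k,i,t$, $F'F/T=I_r$, and $\Lambda_{k_*}'\Lambda_{k_*}/N$ is diagonal with non-increasing diagonal elements. Let $\hat\theta=(\hat\Lambda_1,\dots,\hat\Lambda_K,\hat F)$ be any (global)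 minimizer of $M_{NT}$ over $\Theta^r$. For each $(N,T)$ let $X_{it}$ be real random variables and let $\theta^0=(\Lambda^0_1,\dots,\Lambda^0_K,F^0)$ be a non-random parameter; both may depend on $(N,T)$. The following conditions are required for all sufficiently large $N,T$. The $\tau_k$-quantile of $X_{it}$ is $\lambda_{k,i}^{0\prime}f_t^0$ for all $k,i,t$. Moreover: (a) $\mathcal A$ and $\mathcal F$ are compact. (b) $\theta^0\in\Theta^r$, and the diagonal elements of $\Lambda^{0\prime}_{k_*}\Lambda^0_{k_*}/N$ converge, as $N,T\to\infty$, to limits $\nu_1>\nu_2>\dots>\nu_r>0$. (c) $X_{it}$ has a probability density $h_{it}$, and for every compact $C\subset\mathbb R$ there is a constant $c>0$, not depending on $i,t,N,T$, with $h_{it}(x)\ge c$ for all $x\in C$ and all $i,t$. (d) For each $k$, the errors $\epsilon_{k,it}=X_{it}-\lambda_{k,i}^{0\prime}f_t^0$ are independent across $(i,t)$. Let $L_{NT}=\min\{\sqrt N,\sqrt T\}$, let $\hat S=\mathrm{sgn}(\hat F'F^0/T)$, where $\mathrm{sgn}(A)$ is the diagonal matrix of the signs of the diagonal elements of $A$,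 and let $\|\cdot\|$ be the Frobenius norm. Then, as $N,T\to\infty$ jointly, $$\big\|\hat F-F^0\hat S\big\|/\sqrt T=O_p(L_{NT}^{-1})\qquad\text{and}\qquad \big\|\hat\Lambda_k-\Lambda_k^0\hat S\big\|/\sqrt N=O_p(L_{NT}^{-1}),\quad k=1,\dots,K .$$ -/

import Mathlib

open MeasureTheory ProbabilityTheory Filter Topology
open scoped Matrix Matrix.Norms.Frobenius

noncomputable section

namespace DAFM

/-- A parameter `θ`: loading matrices `Λ_1, …, Λ_K` (of size `N × r`, rows `λ_{k,i}'`) and a factor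
matrix `F` (of size `T × r`, rows `f_t'`). -/
structure Params (K r N T : ℕ) where
  loading : Fin K → Matrix (Fin N) (Fin r) ℝ
  factor : Matrix (Fin T) (Fin r) ℝ

/-- The common component `λ_{k,i}' f_t`. -/
def Params.common {K r N T : ℕ} (θ : Params K r N T) (k : Fin K) (i : Fin N) (t : Fin T) : ℝ :=
  θ.loading k i ⬝ᵥ θ.factor t

/-- The normalized Gram matrix `A'A / n` of an `n × r` matrix. -/
def gram {n r : ℕ} (A : Matrix (Fin n) (Fin r) ℝ) : Matrix (Fin r) (Fin r) ℝ :=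
  (n : ℝ)⁻¹ • (Aᵀ * A)

/-- The parameter space `Θ^r`: loadings lie in `𝒜`, factors lie in `ℱ`, `F'F/T = I_r`, and
`Λ_{k*}'Λ_{k*}/N` is diagonal with non-increasing diagonal elements. -/
def paramSpace {K r : ℕ} (𝒜 ℱ : Set (Fin r → ℝ)) (kstar : Fin K) (N T : ℕ) :
    Set (Params K r N T) :=
  {θ | (∀ k i, θ.loading k i ∈ 𝒜) ∧ (∀ t, θ.factor t ∈ ℱ) ∧
    gram θ.factor = 1 ∧
    (gram (θ.loading kstar)).IsDiag ∧ Antitone (gram (θ.loading kstar)).diag}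

open Classical in
/-- The check function `ρ_τ(e) = (τ - 1{e ≤ 0}) e`. -/
def checkFn (τ e : ℝ) : ℝ := (τ - if e ≤ 0 then 1 else 0) * e

/-- The weighted composite objective `M_NT(θ)` for the data matrix `x`. -/
def objective {K r N T : ℕ} (w τ : Fin K → ℝ) (x : Fin N → Fin T → ℝ) (θ : Params K r N T) : ℝ :=
  ((N : ℝ) * T)⁻¹ * ∑ k, ∑ i, ∑ t, w k * checkFn (τ k) (x i t - θ.common k i t)

/-- The `τ`-quantile `inf {x | τ ≤ μ (-∞, x]}` of a probability measure on the line. -/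
def quantile (μ : Measure ℝ) (τ : ℝ) : ℝ := sInf {x | τ ≤ cdf μ x}

/-- `sgn(A)`: the diagonal matrix of the signs of the diagonal elements of `A`. -/
def sgnMatrix {r : ℕ} (A : Matrix (Fin r) (Fin r) ℝ) : Matrix (Fin r) (Fin r) ℝ :=
  Matrix.diagonal fun j => Real.sign (A j j)

/-- `Ŝ = sgn(F̂'F⁰/T)`. -/
def signAlign {K r N T : ℕ} (θ θ₀ : Params K r N T) : Matrix (Fin r) (Fin r) ℝ :=
  sgnMatrix ((T : ℝ)⁻¹ • (θ.factorᵀ * θ₀.factor))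

/-- `L_NT = min {√N, √T}`. -/
def rateL (N T : ℕ) : ℝ := min (Real.sqrt N) (Real.sqrt T)

/-- `Y_NT = O_p(a_NT)` as `N, T → ∞` jointly (the probability is the outer one if `Y_NT` is not
measurable). -/
def IsBigOp {Ω : Type*} [MeasurableSpace Ω] (P : Measure Ω) (Y : ℕ → ℕ → Ω → ℝ) (a : ℕ → ℕ → ℝ) :
    Prop :=
  ∀ ε : ℝ, 0 < ε → ∃ M : ℝ, 0 < M ∧ ∀ᶠ p : ℕ × ℕ in atTop,
    P {ω | M * a p.1 p.2 < |Y p.1 p.2 ω|} ≤ ENNReal.ofReal ε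

end DAFM

end

open DAFM

/-! Minimality enters only through the inequality that the objective at the estimator is at most its
value at the truth. Two facts turn this into a rate for the common components. The expected check
loss grows quadratically around the quantile, because the densities are bounded below on the compact
range of the common components (`sq_le_integral_checkInc_error`). The centred loss process is small
uniformly over arrays of rank at most `2r`, which contain every error `Λ_k F' - Λ⁰_k F⁰'`.

For the second fact, symmetrization and contraction compare the process with a Rademacher process
linear in the array (`integral_sup'_le_signAvg`). On low-rank arrays this is at most the operator
norm of a sign matrix times `√(2r)` times the Frobenius norm (`sum_mul_le_of_lowRank`), and a
discretization shows that the operator norm is of order `√(N + T)` on average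
(`signAvg_gridMax_le`). Markov's inequality then controls a single radius `ϱ`. Convexity makes one
radius enough: a larger error can be shrunk to norm `ϱ` while its loss increment stays nonpositive,
because the class of low-rank arrays is closed under scaling (`sum_norm_commonError_le`). Taking `ϱ`
to be `M √(NT) / L_NT` gives failure probability of order `1/M`.

It remains to pass from `ΛF'` to `Λ` and `F` by a deterministic perturbation argument
(`exists_perturbation_bound`). With normalized factors `U`, `U₀` and overlap `H = U'U₀`, each entry
`H_ij` times the gap between the `i`-th estimated and the `j`-th true eigenvalue is `O(δ)`. The
columns of `H` have nearly unit length, so each true eigenvalue has a nearby estimated one; since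
both lists are ordered and the true one is separated, the matching is the identity. Hence `H` is
close to a diagonal sign matrix. The loadings at every quantile level follow by multiplying the
common components by `U`. -/

namespace DAFM

/-! ### Frobenius norm. -/

section Frobenius

variable {m n l : Type*} [Fintype m] [Fintype n] [Fintype l]

lemma frobenius_norm_sq (A : Matrix m n ℝ) : ‖A‖ ^ 2 = ∑ i, ∑ j, A i j ^ 2 := by
  rw [Matrix.frobenius_norm_def, ← Real.sqrt_eq_rpow, Real.sq_sqrt]
  · simp
  · positivity

lemma frobenius_norm_sq_eq_transpose_mul (A : Matrix m n ℝ) : ‖A‖ ^ 2 = ∑ j, (Aᵀ * A) j j := by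
  rw [frobenius_norm_sq, Finset.sum_comm]
  simp [Matrix.mul_apply, pow_two]

lemma abs_entry_le_frobenius_norm (A : Matrix m n ℝ) (i : m) (j : n) : |A i j| ≤ ‖A‖ := by
  refine abs_le_of_sq_le_sq ?_ (norm_nonneg _)
  rw [frobenius_norm_sq]
  exact (Finset.single_le_sum (f := fun j => A i j ^ 2) (fun _ _ => sq_nonneg _)
    (Finset.mem_univ j)).trans
    (Finset.single_le_sum (f := fun i => ∑ j, A i j ^ 2)
      (fun _ _ => Finset.sum_nonneg fun _ _ => sq_nonneg _) (Finset.mem_univ i))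

lemma frobenius_norm_le_of_abs_le {A B : Matrix m n ℝ} (h : ∀ i j, |A i j| ≤ |B i j|) :
    ‖A‖ ≤ ‖B‖ := by
  refine le_of_sq_le_sq ?_ (norm_nonneg _)
  rw [frobenius_norm_sq, frobenius_norm_sq]
  exact Finset.sum_le_sum fun i _ => Finset.sum_le_sum fun j _ => sq_le_sq.2 (h i j)

lemma frobenius_norm_of_orthonormal {r : ℕ} {U : Matrix m (Fin r) ℝ} (hU : Uᵀ * U = 1) :
    ‖U‖ = Real.sqrt r := by
  rw [← Real.sqrt_sq (norm_nonneg U), frobenius_norm_sq_eq_transpose_mul, hU]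
  simp

end Frobenius

/-! ### Deterministic eigenspace perturbation. -/

section Perturbation

variable {r : ℕ} {m n : Type*} [Fintype m] [Fintype n]

/-- With `C = L * Uᵀ` and `C₀ = L₀ * U₀ᵀ`, sandwiching `CᵀC - C₀ᵀC₀` between `Uᵀ` and `U₀` gives
`(LᵀL)H - H(L₀ᵀL₀)` for `H = Uᵀ * U₀`. Both Gram matrices are diagonal, so its entries are exactly
gap times overlap, while the difference of the products is linear in `C - C₀`. -/
lemma abs_gap_mul_overlap_le {U U₀ : Matrix m (Fin r) ℝ} {L L₀ : Matrix n (Fin r) ℝ} {B δ : ℝ}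
    (hU : Uᵀ * U = 1) (hU₀ : U₀ᵀ * U₀ = 1) (hD : (Lᵀ * L).IsDiag) (hD₀ : (L₀ᵀ * L₀).IsDiag)
    (hL : ‖L‖ ≤ B) (hL₀ : ‖L₀‖ ≤ B) (hδ : ‖L * Uᵀ - L₀ * U₀ᵀ‖ ≤ δ) (i j : Fin r) :
    |((Lᵀ * L) i i - (L₀ᵀ * L₀) j j) * (Uᵀ * U₀) i j| ≤ 2 * r * Real.sqrt r * B * δ := by
  set C := L * Uᵀ with hC
  set C₀ := L₀ * U₀ᵀ with hC₀
  have hB : 0 ≤ B := (norm_nonneg _).trans hL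
  have hδ0 : 0 ≤ δ := (norm_nonneg _).trans hδ
  have key : Uᵀ * (Cᵀ * (C - C₀) + (C - C₀)ᵀ * C₀) * U₀
      = (Lᵀ * L) * (Uᵀ * U₀) - (Uᵀ * U₀) * (L₀ᵀ * L₀) := by
    have e : Cᵀ * (C - C₀) + (C - C₀)ᵀ * C₀ = Cᵀ * C - C₀ᵀ * C₀ := by
      simp only [Matrix.mul_sub, Matrix.transpose_sub, Matrix.sub_mul]; abel
    rw [e, Matrix.mul_sub, Matrix.sub_mul, hC, hC₀]
    simp only [Matrix.transpose_mul, Matrix.transpose_transpose]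
    congr 1
    · rw [show Uᵀ * (U * Lᵀ * (L * Uᵀ)) * U₀ = (Uᵀ * U) * (Lᵀ * L) * (Uᵀ * U₀) by
        simp only [Matrix.mul_assoc], hU, Matrix.one_mul]
    · rw [show Uᵀ * (U₀ * L₀ᵀ * (L₀ * U₀ᵀ)) * U₀ = (Uᵀ * U₀) * (L₀ᵀ * L₀) * (U₀ᵀ * U₀) by
        simp only [Matrix.mul_assoc], hU₀, Matrix.mul_one]
  have ent : ((Lᵀ * L) i i - (L₀ᵀ * L₀) j j) * (Uᵀ * U₀) i j
      = (Uᵀ * (Cᵀ * (C - C₀) + (C - C₀)ᵀ * C₀) * U₀) i j := by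
    have x1 : ((Lᵀ * L) * (Uᵀ * U₀)) i j = (Lᵀ * L) i i * (Uᵀ * U₀) i j := by
      conv_lhs => rw [← hD.diagonal_diag, Matrix.diagonal_mul, Matrix.diag_apply]
    have x2 : ((Uᵀ * U₀) * (L₀ᵀ * L₀)) i j = (Uᵀ * U₀) i j * (L₀ᵀ * L₀) j j := by
      conv_lhs => rw [← hD₀.diagonal_diag, Matrix.mul_diagonal, Matrix.diag_apply]
    rw [key, Matrix.sub_apply, x1, x2]
    ring
  rw [ent]
  refine (abs_entry_le_frobenius_norm _ i j).trans ?_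
  have nU := frobenius_norm_of_orthonormal hU
  have nU₀ := frobenius_norm_of_orthonormal hU₀
  have nC : ‖C‖ ≤ B * Real.sqrt r := by
    refine (Matrix.frobenius_norm_mul _ _).trans ?_
    rw [Matrix.frobenius_norm_transpose, nU]; gcongr
  have nC₀ : ‖C₀‖ ≤ B * Real.sqrt r := by
    refine (Matrix.frobenius_norm_mul _ _).trans ?_
    rw [Matrix.frobenius_norm_transpose, nU₀]; gcongr
  have nE : ‖Cᵀ * (C - C₀) + (C - C₀)ᵀ * C₀‖ ≤ 2 * (B * Real.sqrt r) * δ := by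
    have h1 : ‖Cᵀ * (C - C₀)‖ ≤ (B * Real.sqrt r) * δ := by
      refine (Matrix.frobenius_norm_mul _ _).trans ?_
      rw [Matrix.frobenius_norm_transpose]; gcongr
    have h2 : ‖(C - C₀)ᵀ * C₀‖ ≤ δ * (B * Real.sqrt r) := by
      refine (Matrix.frobenius_norm_mul _ _).trans ?_
      rw [Matrix.frobenius_norm_transpose]; gcongr
    linarith [norm_add_le (Cᵀ * (C - C₀)) ((C - C₀)ᵀ * C₀)]
  calc _ ≤ ‖Uᵀ‖ * ‖Cᵀ * (C - C₀) + (C - C₀)ᵀ * C₀‖ * ‖U₀‖ := by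
        refine (Matrix.frobenius_norm_mul _ _).trans ?_
        gcongr; exact Matrix.frobenius_norm_mul _ _
    _ ≤ Real.sqrt r * (2 * (B * Real.sqrt r) * δ) * Real.sqrt r := by
        rw [Matrix.frobenius_norm_transpose, nU, nU₀]; gcongr
    _ = 2 * (Real.sqrt r * Real.sqrt r) * Real.sqrt r * B * δ := by ring
    _ = _ := by rw [Real.mul_self_sqrt (Nat.cast_nonneg r)]

/-- The rows of `L * Uᵀ` lie in the column span of `U`, so projecting `L₀ * U₀ᵀ` off that span
leaves only projected error. The lower bound `g` on the Gram matrix then cancels `L₀`. -/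
lemma norm_residual_le {U U₀ : Matrix m (Fin r) ℝ} {L L₀ : Matrix n (Fin r) ℝ} {B g δ : ℝ}
    (hg : 0 < g) (hU : Uᵀ * U = 1) (hD₀ : (L₀ᵀ * L₀).IsDiag) (hg₀ : ∀ j, g ≤ (L₀ᵀ * L₀) j j)
    (hL₀ : ‖L₀‖ ≤ B) (hδ : ‖L * Uᵀ - L₀ * U₀ᵀ‖ ≤ δ) :
    ‖U₀ - U * (Uᵀ * U₀)‖ ≤ B * (1 + r) / g * δ := by
  set R := U₀ - U * (Uᵀ * U₀) with hR
  set E := L * Uᵀ - L₀ * U₀ᵀ with hE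
  have hB : 0 ≤ B := (norm_nonneg _).trans hL₀
  have hδ0 : 0 ≤ δ := (norm_nonneg _).trans hδ
  have nU := frobenius_norm_of_orthonormal hU
  have e1 : L₀ * Rᵀ = E * U * Uᵀ - E := by
    have : L * Uᵀ * U * Uᵀ = L * Uᵀ := by
      rw [Matrix.mul_assoc L, hU, Matrix.mul_one]
    simp only [hR, hE, Matrix.transpose_sub, Matrix.transpose_mul, Matrix.transpose_transpose,
      Matrix.mul_sub, Matrix.sub_mul, this]
    simp only [Matrix.mul_assoc]; abel
  have n1 : ‖L₀ * Rᵀ‖ ≤ (1 + r) * δ := by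
    rw [e1]
    have : ‖E * U * Uᵀ‖ ≤ δ * Real.sqrt r * Real.sqrt r := by
      refine (Matrix.frobenius_norm_mul _ _).trans ?_
      rw [Matrix.frobenius_norm_transpose, nU]
      gcongr
      refine (Matrix.frobenius_norm_mul _ _).trans ?_
      rw [nU]; gcongr
    rw [mul_assoc, Real.mul_self_sqrt (Nat.cast_nonneg r)] at this
    linarith [norm_sub_le (E * U * Uᵀ) E]
  have n2 : ‖(L₀ᵀ * L₀) * Rᵀ‖ ≤ B * ((1 + r) * δ) := by
    rw [Matrix.mul_assoc]
    refine (Matrix.frobenius_norm_mul _ _).trans ?_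
    rw [Matrix.frobenius_norm_transpose]; gcongr
  have n3 : ‖g • Rᵀ‖ ≤ ‖(L₀ᵀ * L₀) * Rᵀ‖ := by
    refine frobenius_norm_le_of_abs_le fun j t => ?_
    rw [← hD₀.diagonal_diag, Matrix.diagonal_mul, Matrix.smul_apply, smul_eq_mul, abs_mul, abs_mul,
      Matrix.diag_apply]
    gcongr
    exact hg₀ j
  rw [norm_smul, Matrix.frobenius_norm_transpose, Real.norm_of_nonneg hg.le] at n3
  rw [div_mul_eq_mul_div, le_div_iff₀ hg]
  linarith

/-- Pythagoras: `U * (Uᵀ * U₀)` is the orthogonal projection of `U₀` onto the column span of `U`. -/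
lemma overlap_sq_add_residual_sq {U U₀ : Matrix m (Fin r) ℝ} (hU : Uᵀ * U = 1)
    (hU₀ : U₀ᵀ * U₀ = 1) (j : Fin r) :
    ∑ i, (Uᵀ * U₀) i j ^ 2 + ∑ t, (U₀ - U * (Uᵀ * U₀)) t j ^ 2 = 1 := by
  set H := Uᵀ * U₀ with hH
  have hRR : (U₀ - U * H)ᵀ * (U₀ - U * H) = 1 - Hᵀ * H := by
    have h1 : U₀ᵀ * U = Hᵀ := by simp [hH]
    simp only [Matrix.transpose_sub, Matrix.transpose_mul, Matrix.sub_mul, Matrix.mul_sub]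
    have a1 : Hᵀ * Uᵀ * U₀ = Hᵀ * H := by rw [Matrix.mul_assoc]
    have a2 : Hᵀ * Uᵀ * (U * H) = Hᵀ * H := by
      rw [show Hᵀ * Uᵀ * (U * H) = Hᵀ * (Uᵀ * U) * H by simp only [Matrix.mul_assoc], hU,
        Matrix.mul_one]
    have a3 : U₀ᵀ * (U * H) = Hᵀ * H := by rw [← Matrix.mul_assoc, h1]
    rw [a1, a2, a3, hU₀]; abel
  have := congrFun (congrFun hRR j) j
  simp only [Matrix.mul_apply, Matrix.transpose_apply, Matrix.sub_apply (1 : Matrix _ _ ℝ),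
    Matrix.one_apply_eq, ← pow_two] at this
  linarith

/-- Eigenspace perturbation: if the rank-`r` matrices `L * Uᵀ` and `L₀ * U₀ᵀ` are close, `U` and `U₀`
are orthonormal and the (ordered, diagonal) Gram matrix of `L₀` has separated entries, then `U` and
`U₀` are close up to the signs of the columns. -/
theorem exists_perturbation_bound (r : ℕ) {B g : ℝ} (hB : 0 ≤ B) (hg : 0 < g) :
    ∃ C > 0, ∃ δ₀ > 0, ∀ {m n : ℕ} {U U₀ : Matrix (Fin m) (Fin r) ℝ}
      {L L₀ : Matrix (Fin n) (Fin r) ℝ} {δ : ℝ}, Uᵀ * U = 1 → U₀ᵀ * U₀ = 1 →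
      (Lᵀ * L).IsDiag → Antitone (Lᵀ * L).diag → (L₀ᵀ * L₀).IsDiag →
      (∀ j, g ≤ (L₀ᵀ * L₀) j j) → (∀ i j, i < j → (L₀ᵀ * L₀) j j + g ≤ (L₀ᵀ * L₀) i i) →
      ‖L‖ ≤ B → ‖L₀‖ ≤ B → ‖L * Uᵀ - L₀ * U₀ᵀ‖ ≤ δ → δ ≤ δ₀ →
      ‖U - U₀ * sgnMatrix (Uᵀ * U₀)‖ ≤ C * δ := by
  obtain ⟨a, ha⟩ : ∃ a : ℝ, a = 2 * r * Real.sqrt r * B := ⟨_, rfl⟩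
  obtain ⟨b, hb⟩ : ∃ b : ℝ, b = B * (1 + r) / g := ⟨_, rfl⟩
  -- `q * δ ^ 2` will bound the squared mass of a column of `U₀` missing from `H j j`: `b` accounts
  -- for the residual, the middle term for the off-diagonal overlaps. The final `1` makes `q ≥ 1`,
  -- so that `δ ≤ 1 / (2q)` forces `q * δ ^ 2 ≤ 1 / 2`.
  obtain ⟨q, hq⟩ : ∃ q : ℝ, q = b ^ 2 + r * (4 * a / (3 * g)) ^ 2 + 1 := ⟨_, rfl⟩
  have ha0 : 0 ≤ a := by rw [ha]; positivity
  have hb0 : 0 ≤ b := by rw [hb]; positivity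
  have hq1 : 1 ≤ q := by rw [hq]; linarith [show 0 ≤ b ^ 2 + r * (4 * a / (3 * g)) ^ 2 by positivity]
  -- Chosen so that `δ < e` puts matched eigenvalues within `g / 4` of each other.
  obtain ⟨e, he⟩ : ∃ e : ℝ, e = g / (4 * (a * Real.sqrt (2 * r) + 1)) := ⟨_, rfl⟩
  have he0 : 0 < e := by rw [he]; positivity
  -- `r + 1` in place of `r` keeps the constant positive when `r = 0`.
  refine ⟨Real.sqrt (2 * q * (r + 1)), Real.sqrt_pos.2 (by positivity), min (1 / (2 * q)) (e / 2),
    by positivity, ?_⟩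
  intro m n U U₀ L L₀ δ hU hU₀ hD hanti hD₀ hg₀ hgap hL hL₀ hδ hδ₀
  have hδ0 : 0 ≤ δ := (norm_nonneg _).trans hδ
  have hδq : q * δ ^ 2 ≤ 1 / 2 := by
    have h1 : δ ≤ 1 / (2 * q) := hδ₀.trans (min_le_left _ _)
    have h2 : δ * (2 * q) ≤ 1 := by rwa [le_div_iff₀ (by positivity)] at h1
    have h3 : δ ≤ 1 := h1.trans (by rw [div_le_one (by positivity)]; linarith)
    nlinarith
  have hδe : a * Real.sqrt (2 * r) * δ < g / 4 := by
    have h1 : δ < e := (hδ₀.trans (min_le_right _ _)).trans_lt (by linarith)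
    rw [he, lt_div_iff₀ (by positivity)] at h1
    nlinarith
  set H := Uᵀ * U₀ with hH
  have hcross : ∀ i j, |(Lᵀ * L) i i - (L₀ᵀ * L₀) j j| * |H i j| ≤ a * δ := fun i j => by
    rw [← abs_mul, ha]; exact abs_gap_mul_overlap_le hU hU₀ hD hD₀ hL hL₀ hδ i j
  have hres := norm_residual_le hg hU hD₀ hg₀ hL₀ hδ
  rw [← hb] at hres
  have hcol := overlap_sq_add_residual_sq hU hU₀
  have hcolR : ∀ j, ∑ t, (U₀ - U * (Uᵀ * U₀)) t j ^ 2 ≤ b ^ 2 * δ ^ 2 := fun j => by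
    calc _ ≤ ‖U₀ - U * (Uᵀ * U₀)‖ ^ 2 := by
          rw [frobenius_norm_sq, Finset.sum_comm]
          exact Finset.single_le_sum (f := fun j => ∑ t, (U₀ - U * (Uᵀ * U₀)) t j ^ 2)
            (fun _ _ => Finset.sum_nonneg fun _ _ => sq_nonneg _) (Finset.mem_univ j)
      _ ≤ (b * δ) ^ 2 := by gcongr
      _ = _ := by ring
  have hcolR0 : ∀ j, 0 ≤ ∑ t, (U₀ - U * (Uᵀ * U₀)) t j ^ 2 := fun j =>
    Finset.sum_nonneg fun _ _ => sq_nonneg _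
  have hbq : b ^ 2 * δ ^ 2 ≤ 1 / 2 := by
    refine le_trans ?_ hδq
    gcongr
    rw [hq]; linarith [show 0 ≤ r * (4 * a / (3 * g)) ^ 2 by positivity]
  -- At least half of the squared mass of column `j` lies in `H`, so some entry satisfies `H i j ^ 2
  -- ≥ 1 / (2r)`; its eigenvalue gap must then be small.
  have hmatch : ∀ j, ∃ i, |(Lᵀ * L) i i - (L₀ᵀ * L₀) j j| < g / 4 := fun j => by
    have hr : 0 < r := j.pos
    have hr' : (0 : ℝ) < r := by exact_mod_cast hr
    obtain ⟨i, -, hi⟩ : ∃ i ∈ Finset.univ, 1 / (2 * r : ℝ) ≤ H i j ^ 2 := by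
      refine Finset.exists_le_of_sum_le ⟨j, Finset.mem_univ j⟩ ?_
      simp only [Finset.sum_const, Finset.card_univ, Fintype.card_fin, nsmul_eq_mul]
      rw [show (r : ℝ) * (1 / (2 * r)) = 1 / 2 by field_simp]
      linarith [hcol j, hcolR j]
    refine ⟨i, lt_of_le_of_lt ?_ hδe⟩
    have h1 : 1 ≤ Real.sqrt (2 * r) * |H i j| := by
      rw [← Real.sqrt_sq_eq_abs, ← Real.sqrt_mul (by positivity)]
      rw [Real.one_le_sqrt]
      rw [div_le_iff₀ (by positivity)] at hi; linarith
    calc _ = |(Lᵀ * L) i i - (L₀ᵀ * L₀) j j| * 1 := (mul_one _).symm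
      _ ≤ |(Lᵀ * L) i i - (L₀ᵀ * L₀) j j| * (Real.sqrt (2 * r) * |H i j|) := by gcongr
      _ = (|(Lᵀ * L) i i - (L₀ᵀ * L₀) j j| * |H i j|) * Real.sqrt (2 * r) := by ring
      _ ≤ (a * δ) * Real.sqrt (2 * r) := mul_le_mul_of_nonneg_right (hcross i j) (by positivity)
      _ = _ := by ring
  choose φ hφ using hmatch
  -- An order reversal would contradict the separation: the true gap is at least `g`, and matching
  -- moves the two ends by less than `g / 2` in total. A strictly monotone self-map of `Fin r` is
  -- the identity.
  have hmono : StrictMono φ := fun i j hij => by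
    by_contra hcon
    have h1 : (Lᵀ * L) (φ i) (φ i) ≤ (Lᵀ * L) (φ j) (φ j) := hanti (not_lt.1 hcon)
    have h2 := abs_lt.1 (hφ i)
    have h3 := abs_lt.1 (hφ j)
    have h4 := hgap i j hij
    linarith
  have hid : φ = id := hmono.eq_id
  have hoff : ∀ i j, i ≠ j → |H i j| ≤ 4 * a / (3 * g) * δ := fun i j hij => by
    have h1 : 3 * g / 4 ≤ |(Lᵀ * L) i i - (L₀ᵀ * L₀) j j| := by
      have h2 := abs_lt.1 (hφ i)
      rw [hid, id] at h2
      rcases lt_or_gt_of_ne hij with h | h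
      · have := hgap i j h
        exact le_trans (by linarith) (le_abs_self _)
      · have := hgap j i h
        exact le_trans (by linarith) (neg_le_abs _)
    have h2 := hcross i j
    rw [div_mul_eq_mul_div, le_div_iff₀ (by positivity)]
    nlinarith [abs_nonneg (H i j)]
  have hdiag : ∀ j, 1 - q * δ ^ 2 ≤ H j j ^ 2 := fun j => by
    have h1 : ∑ i, H i j ^ 2 ≤ H j j ^ 2 + r * ((4 * a / (3 * g)) * δ) ^ 2 := by
      rw [← Finset.add_sum_erase _ _ (Finset.mem_univ j)]
      gcongr
      calc _ ≤ ∑ i ∈ Finset.univ.erase j, ((4 * a / (3 * g)) * δ) ^ 2 := by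
            refine Finset.sum_le_sum fun i hi => ?_
            rw [← sq_abs (H i j)]
            gcongr
            exact hoff i j (Finset.ne_of_mem_erase hi)
        _ ≤ ∑ i : Fin r, ((4 * a / (3 * g)) * δ) ^ 2 :=
            Finset.sum_le_sum_of_subset_of_nonneg (Finset.erase_subset _ _)
              fun _ _ _ => sq_nonneg _
        _ = _ := by simp
    have h2 := hcol j
    have h3 := hcolR j
    rw [hq]
    nlinarith [sq_nonneg δ]
  have hle : ∀ j, |H j j| ≤ 1 := fun j => by
    rw [← sq_le_one_iff_abs_le_one]
    have h1 : H j j ^ 2 ≤ ∑ i, H i j ^ 2 :=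
      Finset.single_le_sum (f := fun i => H i j ^ 2) (fun _ _ => sq_nonneg _) (Finset.mem_univ j)
    linarith [hcol j, hcolR0 j]
  have hcoldist : ∀ j, ∑ t, (U t j - U₀ t j * Real.sign (H j j)) ^ 2 ≤ 2 * q * δ ^ 2 := fun j => by
    have hne : H j j ≠ 0 := fun h0 => by
      have := hdiag j; rw [h0] at this; linarith
    have hs : Real.sign (H j j) ^ 2 = 1 := by
      rcases Real.sign_apply_eq_of_ne_zero _ hne with h | h <;> rw [h] <;> norm_num
    have hs' : Real.sign (H j j) * H j j = |H j j| := by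
      rcases lt_or_gt_of_ne hne with h | h
      · rw [Real.sign_of_neg h, abs_of_neg h]; ring
      · rw [Real.sign_of_pos h, abs_of_pos h]; ring
    have h1 : ∑ t, U t j ^ 2 = 1 := by
      have := congrFun (congrFun hU j) j
      simpa [Matrix.mul_apply, pow_two] using this
    have h2 : ∑ t, U₀ t j ^ 2 = 1 := by
      have := congrFun (congrFun hU₀ j) j
      simpa [Matrix.mul_apply, pow_two] using this
    have h3 : ∑ t, U t j * U₀ t j = H j j := by simp [hH, Matrix.mul_apply]
    have h4 : ∑ t, (U t j - U₀ t j * Real.sign (H j j)) ^ 2 = 2 - 2 * |H j j| := by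
      have : ∀ t, (U t j - U₀ t j * Real.sign (H j j)) ^ 2
          = U t j ^ 2 - 2 * Real.sign (H j j) * (U t j * U₀ t j)
            + Real.sign (H j j) ^ 2 * U₀ t j ^ 2 := fun t => by ring
      simp only [this, Finset.sum_add_distrib, Finset.sum_sub_distrib, ← Finset.mul_sum, h1, h2, h3,
        hs, ← hs']
      ring
    rw [h4]
    have h5 := hdiag j
    rw [← sq_abs (H j j)] at h5
    nlinarith [hle j, abs_nonneg (H j j)]
  refine le_of_sq_le_sq ?_ (by positivity)
  rw [mul_pow, Real.sq_sqrt (by positivity), frobenius_norm_sq, Finset.sum_comm]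
  calc _ = ∑ j, ∑ t, (U t j - U₀ t j * Real.sign (H j j)) ^ 2 := by
        simp [sgnMatrix, Matrix.mul_diagonal]
    _ ≤ ∑ j : Fin r, 2 * q * δ ^ 2 := Finset.sum_le_sum fun j _ => hcoldist j
    _ = r * (2 * q * δ ^ 2) := by simp
    _ ≤ _ := by nlinarith [sq_nonneg δ, mul_nonneg (by linarith : 0 ≤ q) (sq_nonneg δ)]

end Perturbation

/-! ### Symmetrization, contraction and a tail bound. -/

section Symmetrization

/-- The real sign `±1` encoded by a Boolean. -/
def boolSign (b : Bool) : ℝ := if b then 1 else -1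

lemma boolSign_not (b : Bool) : boolSign (!b) = -boolSign b := by cases b <;> simp [boolSign]

/-- The average of a function of a vector of independent Rademacher signs. -/
noncomputable def signAvg {ι : Type*} [Fintype ι] [DecidableEq ι] (f : (ι → Bool) → ℝ) : ℝ :=
  (2 ^ Fintype.card ι : ℝ)⁻¹ * ∑ σ, f σ

section signAvg

variable {ι : Type*} [Fintype ι] [DecidableEq ι]

lemma signAvg_mono {f g : (ι → Bool) → ℝ} (h : ∀ σ, f σ ≤ g σ) : signAvg f ≤ signAvg g :=
  mul_le_mul_of_nonneg_left (Finset.sum_le_sum fun σ _ => h σ) (by positivity)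

lemma signAvg_add (f g : (ι → Bool) → ℝ) :
    signAvg (fun σ => f σ + g σ) = signAvg f + signAvg g := by
  simp [signAvg, Finset.sum_add_distrib, mul_add]

lemma signAvg_const_mul (c : ℝ) (f : (ι → Bool) → ℝ) :
    signAvg (fun σ => c * f σ) = c * signAvg f := by
  simp only [signAvg, ← Finset.mul_sum]; ring

lemma signAvg_const (c : ℝ) : signAvg (fun _ : ι → Bool => c) = c := by
  simp [signAvg]

lemma signAvg_flip (a : ι) (f : (ι → Bool) → ℝ) :
    signAvg (fun σ => f (Function.update σ a (!σ a))) = signAvg f := by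
  have hinv : Function.Involutive fun σ : ι → Bool => Function.update σ a (!σ a) := fun σ => by
    ext i; by_cases h : i = a
    · subst h; simp
    · simp [h]
  unfold signAvg
  congr 1
  exact Equiv.sum_comp hinv.toPerm f

end signAvg

variable {κ : Type*}

lemma abs_sup'_le {D : Finset κ} (hD : D.Nonempty) {f : κ → ℝ} {c : ℝ}
    (h : ∀ d ∈ D, |f d| ≤ c) : |D.sup' hD f| ≤ c := by
  obtain ⟨d, hd, he⟩ := Finset.exists_mem_eq_sup' hD f
  rw [he]; exact h d hd

/-- Take maximizers `i` and `j` of the two suprema on the left. The sign of `d i - d j` decides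
which of them is evaluated with `+2d` and which with `-2d` on the right. -/
lemma sup'_add_sup'_le {D : Finset κ} (hD : D.Nonempty) (a d φ : κ → ℝ)
    (hφ : ∀ i j, |φ i - φ j| ≤ 2 * |d i - d j|) :
    D.sup' hD (fun i => a i + φ i) + D.sup' hD (fun i => a i - φ i)
      ≤ D.sup' hD (fun i => a i + 2 * d i) + D.sup' hD (fun i => a i - 2 * d i) := by
  obtain ⟨i, hi, hi'⟩ := Finset.exists_mem_eq_sup' hD (fun i => a i + φ i)
  obtain ⟨j, hj, hj'⟩ := Finset.exists_mem_eq_sup' hD (fun i => a i - φ i)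
  rw [hi', hj']
  have h1 := le_abs_self (φ i - φ j)
  have h2 := hφ i j
  have pi := Finset.le_sup' (fun i => a i + 2 * d i) hi
  have pj := Finset.le_sup' (fun i => a i + 2 * d i) hj
  have mi := Finset.le_sup' (fun i => a i - 2 * d i) hi
  have mj := Finset.le_sup' (fun i => a i - 2 * d i) hj
  rcases abs_cases (d i - d j) with ⟨h, -⟩ | ⟨h, -⟩ <;> rw [h] at h2 <;> linarith

lemma measurable_sup'_apply {β : Type*} [MeasurableSpace β] {D : Finset κ} (hD : D.Nonempty)
    {f : κ → β → ℝ} (hf : ∀ d, Measurable (f d)) :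
    Measurable fun x => D.sup' hD fun d => f d x := by
  have := Finset.measurable_sup' hD (f := f) fun d _ => hf d
  convert! this using 2
  simp

/-- Symmetrization and contraction of a single coordinate. -/
lemma integral_sup'_symmetrize (μ : Measure ℝ) [IsProbabilityMeasure μ] {D : Finset κ}
    (hD : D.Nonempty) (a d : κ → ℝ) {g : ℝ → ℝ → ℝ} (hg : ∀ y, Measurable fun x => g x y)
    (hlip : ∀ x y z, |g x y - g x z| ≤ |y - z|) (h0 : ∀ x, g x 0 = 0) :
    ∫ x, D.sup' hD (fun i => a i + (g x (d i) - ∫ y, g y (d i) ∂μ)) ∂μ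
      ≤ 2⁻¹ * (D.sup' hD (fun i => a i + 2 * d i) + D.sup' hD (fun i => a i - 2 * d i)) := by
  have hgb : ∀ x y, |g x y| ≤ |y| := fun x y => by simpa [h0] using hlip x y 0
  have hgi : ∀ y, Integrable (fun x => g x y) μ := fun y =>
    Integrable.of_bound (hg y).aestronglyMeasurable |y| (ae_of_all _ fun x => hgb x y)
  obtain ⟨c, hc⟩ : ∃ c, ∀ i ∈ D, |a i| + 2 * |d i| ≤ c :=
    ⟨D.sup' hD fun i => |a i| + 2 * |d i|, fun i hi => Finset.le_sup' (fun i => |a i| + 2 * |d i|) hi⟩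
  let Ψ : ℝ × ℝ → ℝ := fun p => D.sup' hD fun i => a i + (g p.1 (d i) - g p.2 (d i))
  have hΨm : Measurable Ψ := measurable_sup'_apply hD fun i =>
    (((hg (d i)).comp measurable_fst).sub ((hg (d i)).comp measurable_snd)).const_add (a i)
  have hΨb : ∀ p, |Ψ p| ≤ c := fun p => abs_sup'_le hD fun i hi => by
    refine le_trans ?_ (hc i hi)
    have h1 := hgb p.1 (d i)
    have h2 := hgb p.2 (d i)
    have h3 := abs_add_le (a i) (g p.1 (d i) - g p.2 (d i))
    have h4 := abs_sub (g p.1 (d i)) (g p.2 (d i))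
    linarith
  have hΨi : Integrable Ψ (μ.prod μ) :=
    Integrable.of_bound hΨm.aestronglyMeasurable c (ae_of_all _ hΨb)
  have hΨi' : ∀ x, Integrable (fun y => Ψ (x, y)) μ := fun x =>
    Integrable.of_bound (hΨm.comp measurable_prodMk_left).aestronglyMeasurable c
      (ae_of_all _ fun y => hΨb _)
  -- Jensen: the mean is replaced by an independent copy `y`, and the maximum of integrals is at
  -- most the integral of the maximum.
  have step : ∀ x, D.sup' hD (fun i => a i + (g x (d i) - ∫ y, g y (d i) ∂μ))
      ≤ ∫ y, Ψ (x, y) ∂μ := fun x => by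
    refine Finset.sup'_le _ _ fun i hi => ?_
    have : a i + (g x (d i) - ∫ y, g y (d i) ∂μ) = ∫ y, (a i + (g x (d i) - g y (d i))) ∂μ := by
      have e1 : ∫ y, (g x (d i) - g y (d i)) ∂μ = g x (d i) - ∫ y, g y (d i) ∂μ := by
        rw [integral_sub (integrable_const _) (hgi _)]; simp
      have e2 : ∫ y, (a i + (g x (d i) - g y (d i))) ∂μ
          = ∫ _, a i ∂μ + ∫ y, (g x (d i) - g y (d i)) ∂μ :=
        integral_add (integrable_const _) ((integrable_const _).sub (hgi _))
      rw [e2, e1]; simp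
    rw [this]
    exact integral_mono ((integrable_const _).add ((integrable_const _).sub (hgi _))) (hΨi' x)
      fun y => Finset.le_sup' (fun i => a i + (g x (d i) - g y (d i))) hi
  have hlm : Measurable fun x => D.sup' hD (fun i => a i + (g x (d i) - ∫ y, g y (d i) ∂μ)) :=
    measurable_sup'_apply hD fun i => ((hg (d i)).sub_const _).const_add _
  have hli : Integrable (fun x => D.sup' hD (fun i => a i + (g x (d i) - ∫ y, g y (d i) ∂μ))) μ := by
    refine Integrable.of_bound hlm.aestronglyMeasurable c (ae_of_all _ fun x => ?_)
    refine abs_sup'_le hD fun i hi => le_trans ?_ (hc i hi)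
    have h1 := hgb x (d i)
    have h2 : |∫ y, g y (d i) ∂μ| ≤ |d i| := by
      have := norm_integral_le_of_norm_le_const (μ := μ) (f := fun y => g y (d i)) (C := |d i|)
        (ae_of_all _ fun y => hgb y (d i))
      simpa using this
    have h3 := abs_add_le (a i) (g x (d i) - ∫ y, g y (d i) ∂μ)
    have h4 := abs_sub (g x (d i)) (∫ y, g y (d i) ∂μ)
    linarith
  have e1 : ∫ x, D.sup' hD (fun i => a i + (g x (d i) - ∫ y, g y (d i) ∂μ)) ∂μ
      ≤ ∫ p, Ψ p ∂(μ.prod μ) := by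
    rw [integral_prod _ hΨi]
    exact integral_mono hli hΨi.integral_prod_left step
  have e2 : ∫ p, Ψ p.swap ∂(μ.prod μ) = ∫ p, Ψ p ∂(μ.prod μ) := integral_prod_swap Ψ
  have e3 : ∫ p, (Ψ p + Ψ p.swap) ∂(μ.prod μ)
      ≤ D.sup' hD (fun i => a i + 2 * d i) + D.sup' hD (fun i => a i - 2 * d i) := by
    calc _ ≤ ∫ _, (D.sup' hD (fun i => a i + 2 * d i) + D.sup' hD (fun i => a i - 2 * d i))
          ∂(μ.prod μ) := by
          -- Swapping the two copies flips the sign of `g p.1 (d i) - g p.2 (d i)`. This difference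
          -- is 2-Lipschitz in `d i`, so contraction applies pointwise.
          refine integral_mono (hΨi.add hΨi.swap) (integrable_const _) fun p => ?_
          refine le_trans (le_of_eq ?_) (sup'_add_sup'_le hD a d
            (fun i => g p.1 (d i) - g p.2 (d i)) fun i j => ?_)
          · refine congrArg₂ _ rfl ?_
            show D.sup' hD (fun i => a i + (g p.2 (d i) - g p.1 (d i))) = _
            refine congrArg _ (funext fun i => ?_)
            ring
          · have h1 := hlip p.1 (d i) (d j)
            have h2 := hlip p.2 (d i) (d j)
            have h4 := abs_sub (g p.1 (d i) - g p.1 (d j)) (g p.2 (d i) - g p.2 (d j))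
            rw [show g p.1 (d i) - g p.2 (d i) - (g p.1 (d j) - g p.2 (d j))
              = (g p.1 (d i) - g p.1 (d j)) - (g p.2 (d i) - g p.2 (d j)) by ring]
            linarith
      _ = _ := by simp
  have e4 : ∫ p, (Ψ p + Ψ p.swap) ∂(μ.prod μ) = ∫ p, Ψ p ∂(μ.prod μ)
      + ∫ p, Ψ p.swap ∂(μ.prod μ) := integral_add hΨi hΨi.swap
  rw [e4, e2] at e3
  linarith

variable {Ω : Type*} [MeasurableSpace Ω] {P : Measure Ω} [IsProbabilityMeasure P]

lemma integral_comp_le_of_indepFun {β : Type*} [MeasurableSpace β] {V : Ω → β} {U : Ω → ℝ}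
    (hV : Measurable V) (hU : Measurable U) (hind : IndepFun V U P) {f : β → ℝ → ℝ} {F : β → ℝ}
    (hf : Measurable fun p : β × ℝ => f p.1 p.2) (hF : Measurable F) {c : ℝ}
    (hfb : ∀ v x, |f v x| ≤ c) (hFb : ∀ v, |F v| ≤ c) (h : ∀ v, ∫ x, f v x ∂(P.map U) ≤ F v) :
    ∫ ω, f (V ω) (U ω) ∂P ≤ ∫ ω, F (V ω) ∂P := by
  have hmV : IsProbabilityMeasure (P.map V) := Measure.isProbabilityMeasure_map hV.aemeasurable
  have hmU : IsProbabilityMeasure (P.map U) := Measure.isProbabilityMeasure_map hU.aemeasurable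
  have e := (indepFun_iff_map_prod_eq_prod_map_map hV.aemeasurable hU.aemeasurable).1 hind
  have hfi : Integrable (fun p : β × ℝ => f p.1 p.2) ((P.map V).prod (P.map U)) :=
    Integrable.of_bound hf.aestronglyMeasurable c (ae_of_all _ fun p => hfb _ _)
  have hFi : Integrable F (P.map V) :=
    Integrable.of_bound hF.aestronglyMeasurable c (ae_of_all _ hFb)
  calc ∫ ω, f (V ω) (U ω) ∂P = ∫ p, f p.1 p.2 ∂(P.map fun ω => (V ω, U ω)) := by
        rw [integral_map (hV.prodMk hU).aemeasurable hf.aestronglyMeasurable]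
    _ = ∫ v, ∫ x, f v x ∂(P.map U) ∂(P.map V) := by rw [e, integral_prod _ hfi]
    _ ≤ ∫ v, F v ∂(P.map V) := integral_mono hfi.integral_prod_left hFi h
    _ = _ := integral_map hV.aemeasurable hF.aestronglyMeasurable

variable {ι : Type*} [Fintype ι] [DecidableEq ι]

/-- Symmetrization and contraction: the expected maximum of a centred Lipschitz process with
independent coordinates is at most the average maximum of twice the Rademacher process. -/
theorem integral_sup'_le_signAvg {U : ι → Ω → ℝ} (hU : ∀ i, Measurable (U i))
    (hind : iIndepFun U P) {g : ι → ℝ → ℝ → ℝ} (hg : ∀ i y, Measurable fun x => g i x y)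
    (hlip : ∀ i x y z, |g i x y - g i x z| ≤ |y - z|) (h0 : ∀ i x, g i x 0 = 0)
    {D : Finset (ι → ℝ)} (hD : D.Nonempty) (s : Finset ι) (B : (ι → ℝ) → ℝ) :
    ∫ ω, D.sup' hD (fun d => B d + ∑ i ∈ s, (g i (U i ω) (d i) - ∫ y, g i y (d i) ∂(P.map (U i)))) ∂P
      ≤ signAvg fun σ => D.sup' hD fun d => B d + ∑ i ∈ s, 2 * (boolSign (σ i) * d i) := by
  -- The offset `B` must stay free: integrating out coordinate `a` with the others frozen replaces
  -- it by `B d ± 2 * d a`, and the induction hypothesis is used for both signs.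
  induction s using Finset.induction_on generalizing B with
  | empty => simp [signAvg_const]
  | insert a s ha ih =>
    have hm : ∀ i, IsProbabilityMeasure (P.map (U i)) := fun i =>
      Measure.isProbabilityMeasure_map (hU i).aemeasurable
    have hgb : ∀ i x y, |g i x y| ≤ |y| := fun i x y => by simpa [h0] using hlip i x y 0
    have hmb : ∀ i y, |∫ x, g i x y ∂(P.map (U i))| ≤ |y| := fun i y => by
      have := norm_integral_le_of_norm_le_const (μ := P.map (U i)) (f := fun x => g i x y)
        (C := |y|) (ae_of_all _ fun x => hgb i x y)
      simpa using this
    have hdev : ∀ i x y, |g i x y - ∫ x, g i x y ∂(P.map (U i))| ≤ 2 * |y| := fun i x y => by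
      linarith [abs_sub (g i x y) (∫ x, g i x y ∂(P.map (U i))), hgb i x y, hmb i y]
    let S : ({i // i ∈ s} → ℝ) → (ι → ℝ) → ℝ := fun v d =>
      ∑ i : {i // i ∈ s}, (g i (v i) (d i) - ∫ y, g i y (d i) ∂(P.map (U i)))
    have hSU : ∀ ω d, S (fun i => U i ω) d
        = ∑ i ∈ s, (g i (U i ω) (d i) - ∫ y, g i y (d i) ∂(P.map (U i))) := fun ω d =>
      Finset.sum_coe_sort s fun i => g i (U i ω) (d i) - ∫ y, g i y (d i) ∂(P.map (U i))
    have hSm : ∀ d, Measurable fun v => S v d := fun d =>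
      Finset.measurable_sum _ fun i _ => ((hg i (d i)).comp (measurable_pi_apply i)).sub_const _
    have hSb : ∀ v d, |S v d| ≤ ∑ i ∈ s, 2 * |d i| := fun v d => by
      refine (Finset.abs_sum_le_sum_abs _ _).trans ?_
      rw [← Finset.sum_coe_sort s fun i => 2 * |d i|]
      exact Finset.sum_le_sum fun i _ => hdev _ _ _
    obtain ⟨c, hc⟩ : ∃ c, ∀ d ∈ D, |B d| + ∑ i ∈ s, 2 * |d i| + 2 * |d a| ≤ c :=
      ⟨D.sup' hD fun d => |B d| + ∑ i ∈ s, 2 * |d i| + 2 * |d a|,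
        fun d hd => Finset.le_sup' (fun d => |B d| + ∑ i ∈ s, 2 * |d i| + 2 * |d a|) hd⟩
    have hbd : ∀ v d, d ∈ D → ∀ t, |t| ≤ 2 * |d a| → |B d + S v d + t| ≤ c := fun v d hd t ht => by
      linarith [abs_add_le (B d + S v d) t, abs_add_le (B d) (S v d), hSb v d, hc d hd]
    have h2 : ∀ d : ι → ℝ, |2 * d a| ≤ 2 * |d a| := fun d => by rw [abs_mul, abs_two]
    have h2' : ∀ d : ι → ℝ, |-(2 * d a)| ≤ 2 * |d a| := fun d => by rw [abs_neg]; exact h2 d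
    have hindV : IndepFun (fun ω (i : {i // i ∈ s}) => U i ω) (U a) P := by
      have hp : Measurable fun v : ({i // i ∈ ({a} : Finset ι)} → ℝ) =>
          v ⟨a, Finset.mem_singleton_self a⟩ := measurable_pi_apply _
      have := (hind.indepFun_finset s {a} (Finset.disjoint_singleton_right.2 ha) hU).comp
        measurable_id hp
      exact this
    have hVm : Measurable (fun ω (i : {i // i ∈ s}) => U i ω) := measurable_pi_lambda _ fun i => hU i
    have hFm : ∀ t : (ι → ℝ) → ℝ, Measurable fun v => D.sup' hD fun d => B d + S v d + t d := fun t =>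
      measurable_sup'_apply hD fun d => ((hSm d).const_add _).add_const _
    have hFi : ∀ t : (ι → ℝ) → ℝ, (∀ d, |t d| ≤ 2 * |d a|) →
        Integrable (fun ω => D.sup' hD fun d => B d + S (fun i => U i ω) d + t d) P := fun t ht =>
      Integrable.of_bound ((hFm t).comp hVm).aestronglyMeasurable c
        (ae_of_all _ fun ω => abs_sup'_le hD fun d hd => hbd _ d hd _ (ht d))
    have main : ∫ ω, D.sup' hD (fun d => B d + S (fun i => U i ω) d
          + (g a (U a ω) (d a) - ∫ y, g a y (d a) ∂(P.map (U a)))) ∂P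
        ≤ ∫ ω, 2⁻¹ * (D.sup' hD (fun d => B d + S (fun i => U i ω) d + 2 * d a)
          + D.sup' hD (fun d => B d + S (fun i => U i ω) d + -(2 * d a))) ∂P := by
      refine integral_comp_le_of_indepFun (V := fun ω (i : {i // i ∈ s}) => U i ω) (U := U a)
        (f := fun v x => D.sup' hD (fun d => B d + S v d
          + (g a x (d a) - ∫ y, g a y (d a) ∂(P.map (U a)))))
        (F := fun v => 2⁻¹ * (D.sup' hD (fun d => B d + S v d + 2 * d a)
          + D.sup' hD (fun d => B d + S v d + -(2 * d a)))) (c := c)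
        hVm (hU a) hindV ?_ ?_ ?_ ?_ ?_
      · exact measurable_sup'_apply hD fun d => (((hSm d).comp measurable_fst).const_add _).add
          (((hg a (d a)).comp measurable_snd).sub_const _)
      · exact ((hFm _).add (hFm _)).const_mul _
      · exact fun v x => abs_sup'_le hD fun d hd => hbd _ d hd _ (hdev _ _ _)
      · intro v
        have h3 := abs_sup'_le hD fun d hd => hbd v d hd _ (h2 d)
        have h4 := abs_sup'_le hD fun d hd => hbd v d hd _ (h2' d)
        rw [abs_mul, abs_of_pos (by norm_num : (0 : ℝ) < 2⁻¹)]
        linarith [abs_add_le (D.sup' hD fun d => B d + S v d + 2 * d a)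
          (D.sup' hD fun d => B d + S v d + -(2 * d a))]
      · intro v
        have := integral_sup'_symmetrize (P.map (U a)) hD (fun d => B d + S v d) (fun d => d a)
          (hg a) (hlip a) (h0 a)
        simpa only [sub_eq_add_neg] using this
    have hL : ∀ ω, D.sup' hD (fun d => B d
          + ∑ i ∈ insert a s, (g i (U i ω) (d i) - ∫ y, g i y (d i) ∂(P.map (U i))))
        = D.sup' hD (fun d => B d + S (fun i => U i ω) d
          + (g a (U a ω) (d a) - ∫ y, g a y (d a) ∂(P.map (U a)))) := fun ω => by
      congr 1; funext d
      rw [Finset.sum_insert ha, hSU]; ring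
    simp only [hL]
    refine main.trans ?_
    rw [integral_const_mul, integral_add (hFi _ h2) (hFi _ h2')]
    have ih1 := ih fun d => B d + 2 * d a
    have ih2 := ih fun d => B d + -(2 * d a)
    have r1 : ∀ t : (ι → ℝ) → ℝ, ∀ ω, D.sup' hD (fun d => B d + S (fun i => U i ω) d + t d)
        = D.sup' hD (fun d => B d + t d
          + ∑ i ∈ s, (g i (U i ω) (d i) - ∫ y, g i y (d i) ∂(P.map (U i)))) := fun t ω => by
      congr 1; funext d; rw [hSU]; ring
    simp only [r1]
    refine (mul_le_mul_of_nonneg_left (add_le_add ih1 ih2) (by norm_num)).trans (le_of_eq ?_)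
    let G : ℝ → (ι → Bool) → ℝ := fun e σ =>
      D.sup' hD fun d => B d + e * (2 * d a) + ∑ i ∈ s, 2 * (boolSign (σ i) * d i)
    have hGa : ∀ e σ b, G e (Function.update σ a b) = G e σ := fun e σ b => by
      simp only [G]; congr 1; funext d; congr 1
      refine Finset.sum_congr rfl fun i hi => ?_
      rw [Function.update_of_ne (by rintro rfl; exact ha hi)]
    have t1 : (signAvg fun σ => D.sup' hD fun d => B d
        + ∑ i ∈ insert a s, 2 * (boolSign (σ i) * d i)) = signAvg fun σ => G (boolSign (σ a)) σ := by
      congr 1; funext σ; simp only [G]; congr 1; funext d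
      rw [Finset.sum_insert ha]; ring
    have t2 : (signAvg fun σ => G (-boolSign (σ a)) σ) = signAvg fun σ => G (boolSign (σ a)) σ := by
      rw [← signAvg_flip a]
      congr 1; funext σ
      rw [hGa, Function.update_self, boolSign_not, neg_neg]
    have t3 : ∀ σ : ι → Bool, G (boolSign (σ a)) σ + G (-boolSign (σ a)) σ = G 1 σ + G (-1) σ := by
      intro σ
      cases h : σ a
      · simp only [boolSign]; norm_num; ring
      · simp [boolSign]
    have t4 : signAvg (fun σ => G 1 σ) + signAvg (fun σ => G (-1) σ)
        = 2 * signAvg fun σ => G (boolSign (σ a)) σ := by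
      rw [← signAvg_add, ← funext t3, signAvg_add, t2]; ring
    rw [t1]
    have u1 : (signAvg fun σ => D.sup' hD fun d => B d + 2 * d a
        + ∑ i ∈ s, 2 * (boolSign (σ i) * d i)) = signAvg (fun σ => G 1 σ) := by
      simp only [G, one_mul]
    have u2 : (signAvg fun σ => D.sup' hD fun d => B d + -(2 * d a)
        + ∑ i ∈ s, 2 * (boolSign (σ i) * d i)) = signAvg (fun σ => G (-1) σ) := by
      simp only [G, neg_one_mul]
    rw [u1, u2, t4]; ring

/-- Tail bound for the deviation of a Lipschitz process with independent coordinates, uniformly over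
a bounded set `D`, in terms of an upper bound `q` for the Rademacher process on `D`. -/
theorem measure_deviation_le {U : ι → Ω → ℝ} (hU : ∀ i, Measurable (U i))
    (hind : iIndepFun U P) {g : ι → ℝ → ℝ → ℝ} (hg : ∀ i y, Measurable fun x => g i x y)
    (hlip : ∀ i x y z, |g i x y - g i x z| ≤ |y - z|) (h0 : ∀ i x, g i x 0 = 0)
    {D : Set (ι → ℝ)} (hD : Bornology.IsBounded D) (hD0 : 0 ∈ D) {q : (ι → Bool) → ℝ}
    (hq : ∀ σ, ∀ d ∈ D, ∑ i, boolSign (σ i) * d i ≤ q σ) {η : ℝ} (hη : 0 < η) :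
    P {ω | ∃ d ∈ D, η ≤ ∑ i, (∫ y, g i y (d i) ∂(P.map (U i)) - g i (U i ω) (d i))}
      ≤ ENNReal.ofReal (4 * signAvg q / η) := by
  have hm : ∀ i, IsProbabilityMeasure (P.map (U i)) := fun i =>
    Measure.isProbabilityMeasure_map (hU i).aemeasurable
  have hgb : ∀ i x y, |g i x y| ≤ |y| := fun i x y => by simpa [h0] using hlip i x y 0
  have hgi : ∀ i y, Integrable (fun x => g i x y) (P.map (U i)) := fun i y =>
    Integrable.of_bound (hg i y).aestronglyMeasurable |y| (ae_of_all _ fun x => hgb i x y)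
  have hmlip : ∀ i y z, |∫ x, g i x y ∂(P.map (U i)) - ∫ x, g i x z ∂(P.map (U i))| ≤ |y - z| :=
    fun i y z => by
      rw [← integral_sub (hgi i y) (hgi i z)]
      have := norm_integral_le_of_norm_le_const (μ := P.map (U i))
        (f := fun x => g i x y - g i x z) (C := |y - z|) (ae_of_all _ fun x => hlip i x y z)
      simpa using this
  have h1 := fun D' hne => integral_sup'_le_signAvg (P := P) hU hind (g := fun i x y => -g i x y)
    (fun i y => (hg i y).neg)
    (fun i x y z => by
      rw [show -g i x y - -g i x z = -(g i x y - g i x z) by ring, abs_neg]; exact hlip i x y z)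
    (fun i x => by simp [h0]) (D := D') hne Finset.univ (fun _ => 0)
  have hm0 : ∀ i, ∫ x, g i x 0 ∂(P.map (U i)) = 0 := fun i => by simp [h0]
  simp only [integral_neg] at h1
  obtain ⟨m, hmdef⟩ : ∃ m : ι → ℝ → ℝ, ∀ i y, ∫ x, g i x y ∂(P.map (U i)) = m i y :=
    ⟨fun i y => ∫ x, g i x y ∂(P.map (U i)), fun _ _ => rfl⟩
  simp only [hmdef] at h1 hm0 hmlip ⊢
  -- Mesh of a finite net of `D`. Moving to a net point changes each summand by at most `2 * e`,
  -- hence the sum by at most `η / 2`; the `+ 1` covers an empty index type.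
  obtain ⟨e, he⟩ : ∃ e : ℝ, e = η / (4 * (Fintype.card ι + 1)) := ⟨_, rfl⟩
  have he0 : 0 < e := by rw [he]; positivity
  have htb : TotallyBounded D := (Bornology.IsBounded.isCompact_closure hD).totallyBounded.subset subset_closure
  obtain ⟨t, htD, htf, htc⟩ := (totallyBounded_iff_subset.1 htb) _ (Metric.dist_mem_uniformity he0)
  -- Adding `0` to the net makes the maximum `W` nonnegative, as Markov's inequality requires. `W`
  -- is also measurable, although the event over all of `D` need not be.
  obtain ⟨D', hD'⟩ : ∃ D' : Finset (ι → ℝ), (D' : Set (ι → ℝ)) = insert 0 t :=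
    ⟨(htf.insert 0).toFinset, by simp⟩
  have h0D' : (0 : ι → ℝ) ∈ D' := by rw [← Finset.mem_coe, hD']; exact Set.mem_insert _ _
  have hD'D : ∀ d ∈ D', d ∈ D := fun d hd => by
    rw [← Finset.mem_coe, hD'] at hd
    rcases hd with rfl | hd
    exacts [hD0, htD hd]
  have hne : D'.Nonempty := ⟨0, h0D'⟩
  let W : Ω → ℝ := fun ω =>
    D'.sup' hne fun d => ∑ i, (m i (d i) - g i (U i ω) (d i))
  have hWm : Measurable W := by
    refine measurable_sup'_apply hne (f := fun d ω => ∑ i, (m i (d i) - g i (U i ω) (d i)))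
      fun d => ?_
    refine Finset.measurable_sum _ fun i _ => ?_
    exact ((hg i (d i)).comp (hU i)).const_sub _
  have hWle : ∀ ω, ∀ d ∈ D', ∑ i, (m i (d i) - g i (U i ω) (d i)) ≤ W ω := fun ω d hd =>
    Finset.le_sup' (fun d : ι → ℝ => ∑ i, (m i (d i) - g i (U i ω) (d i))) hd
  have hW0 : ∀ ω, 0 ≤ W ω := fun ω => by
    refine le_trans (le_of_eq ?_) (hWle ω 0 h0D')
    simp [h0, hm0]
  have hsub : {ω | ∃ d ∈ D, η ≤ ∑ i, (m i (d i) - g i (U i ω) (d i))}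
      ⊆ {ω | η / 2 ≤ W ω} := by
    rintro ω ⟨d, hd, hdη⟩
    obtain ⟨d', hd't, hdd'⟩ : ∃ d' ∈ t, dist d d' < e := by
      have := htc hd
      simpa using this
    have hd' : d' ∈ D' := by rw [← Finset.mem_coe, hD']; exact Set.mem_insert_of_mem _ hd't
    refine le_trans ?_ (hWle ω d' hd')
    have h1 : ∑ i, (m i (d i) - g i (U i ω) (d i))
        - ∑ i, (m i (d' i) - g i (U i ω) (d' i)) ≤ ∑ _i : ι, 2 * e := by
      rw [← Finset.sum_sub_distrib]
      refine Finset.sum_le_sum fun i _ => ?_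
      have a1 := le_abs_self (m i (d i) - m i (d' i))
      have a2 := neg_abs_le (g i (U i ω) (d i) - g i (U i ω) (d' i))
      have a3 : |d i - d' i| ≤ e := by
        rw [← Real.dist_eq]; exact (dist_le_pi_dist d d' i).trans hdd'.le
      linarith [hmlip i (d i) (d' i), hlip i (U i ω) (d i) (d' i)]
    have h2 : ∑ _i : ι, 2 * e ≤ η / 2 := by
      simp only [Finset.sum_const, Finset.card_univ, nsmul_eq_mul, he]
      rw [mul_div_assoc', mul_div_assoc', div_le_div_iff₀ (by positivity) (by positivity)]
      nlinarith
    linarith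
  have hEW : ∫ ω, W ω ∂P ≤ 2 * signAvg q := by
    have h1 := h1 D' hne
    have h2 : ∀ ω, D'.sup' hne (fun d => 0 + ∑ i, (-g i (U i ω) (d i) - -m i (d i))) = W ω := fun ω => by
      simp only [W]; congr 1; funext d
      rw [zero_add]
      refine Finset.sum_congr rfl fun i _ => ?_
      ring
    simp only [h2] at h1
    refine h1.trans ?_
    rw [← signAvg_const_mul]
    refine signAvg_mono fun σ => Finset.sup'_le _ _ fun d hd => ?_
    rw [zero_add, ← Finset.mul_sum]
    linarith [hq σ d (hD'D d hd)]
  have hWi : Integrable W P := by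
    refine Integrable.of_bound hWm.aestronglyMeasurable
      (D'.sup' hne fun d => ∑ i, 2 * |d i|) (ae_of_all _ fun ω => ?_)
    rw [Real.norm_of_nonneg (hW0 ω)]
    refine Finset.sup'_mono_fun fun d _ => Finset.sum_le_sum fun i _ => ?_
    have a1 := hmlip i (d i) 0
    simp only [hm0, sub_zero] at a1
    linarith [le_abs_self (m i (d i)), neg_abs_le (g i (U i ω) (d i)),
      hgb i (U i ω) (d i)]
  refine (measure_mono hsub).trans ?_
  have hmk := mul_meas_ge_le_integral_of_nonneg (ae_of_all _ hW0) hWi (η / 2)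
  rw [← ofReal_measureReal]
  refine ENNReal.ofReal_le_ofReal ?_
  rw [le_div_iff₀ hη]
  have : η / 2 * P.real {ω | η / 2 ≤ W ω} ≤ 2 * signAvg q := hmk.trans hEW
  linarith

end Symmetrization

/-! ### Low-rank matrices and trace duality. -/

section LowRank

variable {N T : ℕ} {κ : Type*} [Fintype κ]

lemma exists_orthonormal_columns (G : Matrix (Fin N) κ ℝ) :
    ∃ m ≤ Fintype.card κ, ∃ Q : Matrix (Fin N) (Fin m) ℝ, Qᵀ * Q = 1 ∧ Q * (Qᵀ * G) = G := by
  let f : κ → EuclideanSpace ℝ (Fin N) := fun k => WithLp.toLp 2 fun i => G i k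
  let W := Submodule.span ℝ (Set.range f)
  let b := stdOrthonormalBasis ℝ W
  refine ⟨Module.finrank ℝ W, finrank_range_le_card f,
    Matrix.of fun i j => (b j : EuclideanSpace ℝ (Fin N)) i, ?_, ?_⟩
  · ext j k
    have := orthonormal_iff_ite.1 b.orthonormal j k
    rw [Submodule.coe_inner, PiLp.inner_apply] at this
    simp only [Matrix.mul_apply, Matrix.transpose_apply, Matrix.of_apply, Matrix.one_apply]
    rw [← this]
    exact Finset.sum_congr rfl fun i _ => by simp [mul_comm]
  · ext i k
    have hk : f k ∈ W := Submodule.subset_span ⟨k, rfl⟩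
    have h1 := b.sum_repr' ⟨f k, hk⟩
    have h2 := congrArg (fun v : W => (v : EuclideanSpace ℝ (Fin N)) i) h1
    simp only [Submodule.coe_sum, Submodule.coe_smul, Submodule.coe_inner, WithLp.ofLp_sum,
      Finset.sum_apply, WithLp.ofLp_smul, Pi.smul_apply, smul_eq_mul] at h2
    rw [show G i k = (f k) i from rfl, ← h2]
    simp only [Matrix.mul_apply, Matrix.transpose_apply, Matrix.of_apply]
    refine Finset.sum_congr rfl fun j _ => ?_
    rw [mul_comm, PiLp.inner_apply]
    congr 1
    exact Finset.sum_congr rfl fun i _ => by simp [f, mul_comm]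

/-- Duality between the operator norm (bounded by `q`) and the Frobenius norm on matrices of low
rank. -/
lemma sum_mul_le_of_lowRank {A : Matrix (Fin N) (Fin T) ℝ} {q : ℝ} (hq0 : 0 ≤ q)
    (hq : ∀ (u : Fin N → ℝ) (v : Fin T → ℝ), ∑ i, ∑ t, A i t * (u i * v t)
      ≤ q * (Real.sqrt (∑ i, u i ^ 2) * Real.sqrt (∑ t, v t ^ 2)))
    (G : Matrix (Fin N) κ ℝ) (H : Matrix (Fin T) κ ℝ) :
    ∑ i, ∑ t, A i t * (G * Hᵀ) i t ≤ q * (Real.sqrt (Fintype.card κ) * ‖G * Hᵀ‖) := by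
  obtain ⟨m, hm, Q, hQ, hQG⟩ := exists_orthonormal_columns G
  set D := G * Hᵀ with hD
  set R := Qᵀ * D with hR
  have hQR : Q * R = D := by rw [hR, hD, ← Matrix.mul_assoc Qᵀ, ← Matrix.mul_assoc, hQG]
  clear_value R
  have hRn : ‖R‖ ^ 2 = ‖D‖ ^ 2 := by
    rw [frobenius_norm_sq_eq_transpose_mul, frobenius_norm_sq_eq_transpose_mul]
    have : Rᵀ * R = Dᵀ * D := by
      calc Rᵀ * R = Rᵀ * (Qᵀ * Q) * R := by rw [hQ, Matrix.mul_one]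
        _ = (Q * R)ᵀ * (Q * R) := by rw [Matrix.transpose_mul]; simp only [Matrix.mul_assoc]
        _ = _ := by rw [hQR]
    rw [this]
  -- `D` splits into `m` rank-one pieces with unit left factors. Each contributes at most `q` times
  -- the norm of a row of `R`, and Cauchy–Schwarz over the `m` rows costs `√m`.
  have e : ∑ i, ∑ t, A i t * D i t = ∑ j, ∑ i, ∑ t, A i t * (Q i j * R j t) := by
    rw [Finset.sum_comm (s := (Finset.univ : Finset (Fin m)))]
    refine Finset.sum_congr rfl fun i _ => ?_
    rw [Finset.sum_comm]
    refine Finset.sum_congr rfl fun t _ => ?_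
    rw [← Finset.mul_sum]
    congr 1
    rw [← hQR, Matrix.mul_apply]
  rw [e]
  have hcol : ∀ j, ∑ i, Q i j ^ 2 = 1 := fun j => by
    have := congrFun (congrFun hQ j) j
    simpa [Matrix.mul_apply, pow_two] using this
  calc _ ≤ ∑ j, q * Real.sqrt (∑ t, R j t ^ 2) := Finset.sum_le_sum fun j _ => by
        have := hq (fun i => Q i j) (fun t => R j t)
        rwa [hcol, Real.sqrt_one, one_mul] at this
    _ = q * ∑ j, 1 * Real.sqrt (∑ t, R j t ^ 2) := by simp [Finset.mul_sum]
    _ ≤ q * (Real.sqrt (∑ _j : Fin m, 1 ^ 2)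
          * Real.sqrt (∑ j, Real.sqrt (∑ t, R j t ^ 2) ^ 2)) := by
        gcongr
        exact Real.sum_mul_le_sqrt_mul_sqrt _ _ _
    _ = q * (Real.sqrt m * ‖D‖) := by
        have : ∑ j, Real.sqrt (∑ t, R j t ^ 2) ^ 2 = ‖D‖ ^ 2 := by
          rw [← hRn, frobenius_norm_sq]
          exact Finset.sum_congr rfl fun j _ => Real.sq_sqrt (Finset.sum_nonneg fun _ _ => sq_nonneg _)
        rw [this, Real.sqrt_sq (norm_nonneg _)]
        simp
    _ ≤ _ := by gcongr

end LowRank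

/-! ### Operator norm of a Rademacher matrix via a grid. -/

section Grid

/-- Integer vectors in a ball of radius `3 √n`. -/
noncomputable def intGrid (n : ℕ) : Finset (Fin n → ℤ) :=
  (Fintype.piFinset fun _ => Finset.Icc (-(9 * n : ℤ)) (9 * n)).filter
    fun z => ∑ i, z i ^ 2 ≤ 9 * n

lemma mem_intGrid {n : ℕ} {z : Fin n → ℤ} : z ∈ intGrid n ↔ ∑ i, z i ^ 2 ≤ 9 * n := by
  refine ⟨fun h => (Finset.mem_filter.1 h).2, fun h => Finset.mem_filter.2 ⟨?_, h⟩⟩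
  refine Fintype.mem_piFinset.2 fun i => ?_
  have h1 : z i ^ 2 ≤ 9 * n := (Finset.single_le_sum (f := fun i => z i ^ 2)
    (fun _ _ => sq_nonneg _) (Finset.mem_univ i)).trans h
  rw [Finset.mem_Icc]
  constructor <;> nlinarith [Int.le_self_sq (z i), Int.le_self_sq (-z i)]

lemma sum_Icc_exp_neg_sq_le (K : ℕ) :
    ∑ z ∈ Finset.Icc (-(K : ℤ)) K, Real.exp (-(z : ℝ) ^ 2) ≤ 3 := by
  have hb : ∀ k : ℕ, Real.exp (-((k : ℝ) + 1) ^ 2) ≤ (1 / 2) ^ (k + 1) := fun k => by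
    have h1 : Real.exp (-1) ≤ 1 / 2 := by
      rw [Real.exp_neg, one_div]
      gcongr
      linarith [Real.add_one_le_exp 1]
    calc _ ≤ Real.exp (((k + 1 : ℕ) : ℝ) * (-1)) := by
          refine Real.exp_le_exp.2 ?_
          push_cast; nlinarith [(Nat.cast_nonneg k : (0 : ℝ) ≤ k)]
      _ = Real.exp (-1) ^ (k + 1) := Real.exp_nat_mul _ _
      _ ≤ _ := by gcongr
  -- The correction `2 * (1 / 2) ^ K` is the geometric tail still to come on both sides; it lets the
  -- induction close.
  suffices h : ∑ z ∈ Finset.Icc (-(K : ℤ)) K, Real.exp (-(z : ℝ) ^ 2) ≤ 3 - 2 * (1 / 2) ^ K by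
    linarith [show (0 : ℝ) ≤ 2 * (1 / 2) ^ K by positivity]
  induction K with
  | zero => simp; norm_num
  | succ k ih =>
    have hset : Finset.Icc (-((k + 1 : ℕ) : ℤ)) ((k + 1 : ℕ) : ℤ)
        = insert (-((k : ℤ) + 1)) (insert ((k : ℤ) + 1) (Finset.Icc (-(k : ℤ)) k)) := by
      ext z; simp only [Finset.mem_Icc, Finset.mem_insert]; push_cast; omega
    rw [hset, Finset.sum_insert, Finset.sum_insert]
    · have := hb k
      push_cast
      have e : Real.exp (-(-((k : ℝ) + 1)) ^ 2) = Real.exp (-((k : ℝ) + 1) ^ 2) := by ring_nf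
      rw [e]
      have e2 : ((1 : ℝ) / 2) ^ (k + 1) = (1 / 2) ^ k * (1 / 2) := pow_succ _ _
      rw [e2] at this ⊢
      linarith
    · simp
    · simp only [Finset.mem_insert, Finset.mem_Icc]; omega

/-- Exponential counting: each grid point has weight `exp (9n - ∑ z i ^ 2) ≥ 1`, and the sum of the
weights over the enclosing box factorizes into one-dimensional Gaussian sums, each at most `3 ≤ exp
2`. -/
lemma card_intGrid_le (n : ℕ) : ((intGrid n).card : ℝ) ≤ Real.exp (11 * n) := by
  have h3 : (3 : ℝ) ≤ Real.exp 2 := by linarith [Real.add_one_le_exp 2]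
  calc ((intGrid n).card : ℝ) = ∑ z ∈ intGrid n, 1 := by simp
    _ ≤ ∑ z ∈ intGrid n, Real.exp (9 * n) * ∏ i, Real.exp (-(z i : ℝ) ^ 2) := by
        refine Finset.sum_le_sum fun z hz => ?_
        rw [← Real.exp_sum, ← Real.exp_add, Real.one_le_exp_iff, Finset.sum_neg_distrib]
        have : (∑ i, (z i : ℝ) ^ 2) ≤ 9 * n := by exact_mod_cast mem_intGrid.1 hz
        linarith
    _ ≤ ∑ z ∈ Fintype.piFinset fun _ : Fin n => Finset.Icc (-(9 * n : ℤ)) (9 * n),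
          Real.exp (9 * n) * ∏ i, Real.exp (-(z i : ℝ) ^ 2) :=
        Finset.sum_le_sum_of_subset_of_nonneg (Finset.filter_subset _ _)
          fun _ _ _ => by positivity
    _ = Real.exp (9 * n) * ∏ _i : Fin n,
          ∑ z ∈ Finset.Icc (-(9 * n : ℤ)) (9 * n), Real.exp (-(z : ℝ) ^ 2) := by
        rw [← Finset.mul_sum, Finset.prod_univ_sum]
    _ ≤ Real.exp (9 * n) * ∏ _i : Fin n, Real.exp 2 := by
        gcongr
        have := sum_Icc_exp_neg_sq_le (9 * n)
        push_cast at this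
        linarith
    _ = Real.exp (11 * n) := by
        rw [Finset.prod_const, Finset.card_univ, Fintype.card_fin, ← Real.exp_nat_mul,
          ← Real.exp_add]
        congr 1; ring

/-- Rounding toward zero never increases the absolute value, so rounded vectors stay in the ball. -/
lemma exists_int_trunc (x : ℝ) : ∃ z : ℤ, |(z : ℝ)| ≤ |x| ∧ |x - z| ≤ 1 := by
  rcases le_total 0 x with h | h
  · refine ⟨⌊x⌋, ?_, ?_⟩
    · rw [abs_of_nonneg h, abs_of_nonneg (by exact_mod_cast Int.floor_nonneg.2 h)]
      exact Int.floor_le x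
    · rw [abs_of_nonneg (by linarith [Int.floor_le x])]; linarith [Int.lt_floor_add_one x]
  · refine ⟨⌈x⌉, ?_, ?_⟩
    · have : (⌈x⌉ : ℝ) ≤ 0 := by exact_mod_cast Int.ceil_nonpos.2 h
      rw [abs_of_nonpos h, abs_of_nonpos this]; linarith [Int.le_ceil x]
    · rw [abs_le]; constructor <;> linarith [Int.le_ceil x, Int.ceil_lt_add_one x]

/-- Every vector of the unit ball is within `1/3` of a rescaled grid point. -/
lemma exists_intGrid_near {n : ℕ} (hn : 0 < n) {u : Fin n → ℝ} (hu : ∑ i, u i ^ 2 ≤ 1) :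
    ∃ z ∈ intGrid n, ∑ i, (3 * (u i - z i / (3 * Real.sqrt n))) ^ 2 ≤ 1 := by
  have hn' : (0 : ℝ) < n := by exact_mod_cast hn
  have hs : 0 < Real.sqrt n := Real.sqrt_pos.2 hn'
  choose z hz1 hz2 using fun i => exists_int_trunc (3 * Real.sqrt n * u i)
  refine ⟨z, mem_intGrid.2 ?_, ?_⟩
  · have : (∑ i, (z i : ℝ) ^ 2) ≤ 9 * n := by
      calc _ ≤ ∑ i, (3 * Real.sqrt n * u i) ^ 2 :=
            Finset.sum_le_sum fun i _ => sq_le_sq.2 (hz1 i)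
        _ = 9 * n * ∑ i, u i ^ 2 := by
            rw [Finset.mul_sum]
            refine Finset.sum_congr rfl fun i _ => ?_
            rw [mul_pow, mul_pow, Real.sq_sqrt hn'.le]; ring
        _ ≤ _ := by nlinarith
    exact_mod_cast this
  · calc _ ≤ ∑ _i : Fin n, (1 / n : ℝ) := by
          refine Finset.sum_le_sum fun i _ => ?_
          have e : 3 * (u i - z i / (3 * Real.sqrt n))
              = (3 * Real.sqrt n * u i - z i) / Real.sqrt n := by field_simp
          rw [e, div_pow, Real.sq_sqrt hn'.le]
          gcongr
          rw [sq_le_one_iff_abs_le_one]; exact hz2 i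
      _ = 1 := by simp; field_simp

variable {N T : ℕ}

/-- The maximum of the bilinear form of `A` over rescaled grid points. -/
noncomputable def gridMax (A : Matrix (Fin N) (Fin T) ℝ) : ℝ :=
  (intGrid N ×ˢ intGrid T).sup'
    ⟨(0, 0), by simp [Finset.mem_product, mem_intGrid]⟩
    fun p => ∑ i, ∑ t, A i t * ((p.1 i / (3 * Real.sqrt N)) * (p.2 t / (3 * Real.sqrt T)))

lemma gridMax_nonneg (A : Matrix (Fin N) (Fin T) ℝ) : 0 ≤ gridMax A := by
  refine le_trans (le_of_eq ?_) (Finset.le_sup' _ (show ((0, 0) : (Fin N → ℤ) × (Fin T → ℤ))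
    ∈ intGrid N ×ˢ intGrid T by simp [Finset.mem_product, mem_intGrid]))
  simp

lemma isCompact_sum_sq_le_one (n : ℕ) : IsCompact {u : Fin n → ℝ | ∑ i, u i ^ 2 ≤ 1} := by
  refine Metric.isCompact_of_isClosed_isBounded
    (isClosed_le (by fun_prop) continuous_const) ?_
  refine (Metric.isBounded_iff_subset_closedBall 0).2 ⟨1, fun u hu => ?_⟩
  rw [mem_closedBall_zero_iff, pi_norm_le_iff_of_nonneg zero_le_one]
  intro i
  rw [Real.norm_eq_abs, ← sq_le_one_iff_abs_le_one]
  exact (Finset.single_le_sum (f := fun i => u i ^ 2) (fun _ _ => sq_nonneg _)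
    (Finset.mem_univ i)).trans hu

lemma bilin_le_three_mul_gridMax (hN : 0 < N) (hT : 0 < T) (A : Matrix (Fin N) (Fin T) ℝ)
    {u : Fin N → ℝ} {v : Fin T → ℝ} (hu : ∑ i, u i ^ 2 ≤ 1) (hv : ∑ t, v t ^ 2 ≤ 1) :
    ∑ i, ∑ t, A i t * (u i * v t) ≤ 3 * gridMax A := by
  let b : (Fin N → ℝ) → (Fin T → ℝ) → ℝ := fun u v => ∑ i, ∑ t, A i t * (u i * v t)
  have hcomp := (isCompact_sum_sq_le_one N).prod (isCompact_sum_sq_le_one T)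
  obtain ⟨⟨u₀, v₀⟩, ⟨hu₀, hv₀⟩, hmax⟩ := hcomp.exists_isMaxOn ⟨(u, v), hu, hv⟩
    (f := fun p => b p.1 p.2) (by fun_prop)
  have hmax' : ∀ u v, ∑ i, u i ^ 2 ≤ 1 → ∑ t, v t ^ 2 ≤ 1 → b u v ≤ b u₀ v₀ :=
    fun u v hu hv => hmax (show (u, v) ∈ _ from ⟨hu, hv⟩)
  obtain ⟨z, hz, hz'⟩ := exists_intGrid_near hN hu₀
  obtain ⟨y, hy, hy'⟩ := exists_intGrid_near hT hv₀
  have hzball : ∑ i, (z i / (3 * Real.sqrt N) : ℝ) ^ 2 ≤ 1 := by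
    have hN' : (0 : ℝ) < N := by exact_mod_cast hN
    have : (∑ i, (z i : ℝ) ^ 2) ≤ 9 * N := by exact_mod_cast mem_intGrid.1 hz
    calc _ = (∑ i, (z i : ℝ) ^ 2) / (9 * N) := by
          rw [Finset.sum_div]
          refine Finset.sum_congr rfl fun i _ => ?_
          rw [div_pow, mul_pow, Real.sq_sqrt hN'.le]; norm_num
      _ ≤ 1 := by rw [div_le_one (by positivity)]; exact this
  have h1 := hmax' _ v₀ hz' hv₀
  have h2 := hmax' (fun i => z i / (3 * Real.sqrt N)) _ hzball hy'
  have h3 : b (fun i => z i / (3 * Real.sqrt N)) (fun t => y t / (3 * Real.sqrt T)) ≤ gridMax A :=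
    Finset.le_sup' (fun p : (Fin N → ℤ) × (Fin T → ℤ) => ∑ i, ∑ t, A i t *
      ((p.1 i / (3 * Real.sqrt N)) * (p.2 t / (3 * Real.sqrt T)))) (b := (z, y))
      (Finset.mem_product.2 ⟨hz, hy⟩)
  -- At the maximizer, the first two terms are at most `b u₀ v₀` each, because the remainders scaled
  -- by `3` stay in the unit ball. Hence `b u₀ v₀ ≤ 3 * gridMax A`.
  have hsplit : 3 * b u₀ v₀ = b (fun i => 3 * (u₀ i - z i / (3 * Real.sqrt N))) v₀
      + b (fun i => z i / (3 * Real.sqrt N)) (fun t => 3 * (v₀ t - y t / (3 * Real.sqrt T)))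
      + 3 * b (fun i => z i / (3 * Real.sqrt N)) (fun t => y t / (3 * Real.sqrt T)) := by
    simp only [b, Finset.mul_sum, ← Finset.sum_add_distrib]
    refine Finset.sum_congr rfl fun i _ => Finset.sum_congr rfl fun t _ => ?_
    ring
  have h4 := hmax' u v hu hv
  change b u v ≤ _
  linarith

lemma bilin_le_gridMax_mul (hN : 0 < N) (hT : 0 < T) (A : Matrix (Fin N) (Fin T) ℝ)
    (u : Fin N → ℝ) (v : Fin T → ℝ) :
    ∑ i, ∑ t, A i t * (u i * v t)
      ≤ 3 * gridMax A * (Real.sqrt (∑ i, u i ^ 2) * Real.sqrt (∑ t, v t ^ 2)) := by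
  have hz : ∀ {n : ℕ} {u : Fin n → ℝ}, Real.sqrt (∑ i, u i ^ 2) = 0 → ∀ i, u i = 0 := by
    intro n u h i
    rw [Real.sqrt_eq_zero (Finset.sum_nonneg fun _ _ => sq_nonneg _),
      Finset.sum_eq_zero_iff_of_nonneg fun _ _ => sq_nonneg _] at h
    exact pow_eq_zero_iff two_ne_zero |>.1 (h i (Finset.mem_univ i))
  have hunit : ∀ {n : ℕ} {u : Fin n → ℝ}, Real.sqrt (∑ i, u i ^ 2) ≠ 0 →
      ∑ i, (u i / Real.sqrt (∑ i, u i ^ 2)) ^ 2 ≤ 1 := by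
    intro n u h
    simp only [div_pow]
    rw [← Finset.sum_div, Real.sq_sqrt (Finset.sum_nonneg fun _ _ => sq_nonneg _)]
    exact div_self_le_one _
  by_cases hu : Real.sqrt (∑ i, u i ^ 2) = 0
  · simp [hz hu]
  by_cases hv : Real.sqrt (∑ t, v t ^ 2) = 0
  · simp [hz hv]
  have h := bilin_le_three_mul_gridMax hN hT A (hunit hu) (hunit hv)
  have hpu : 0 < Real.sqrt (∑ i, u i ^ 2) := lt_of_le_of_ne (Real.sqrt_nonneg _) (Ne.symm hu)
  have hpv : 0 < Real.sqrt (∑ t, v t ^ 2) := lt_of_le_of_ne (Real.sqrt_nonneg _) (Ne.symm hv)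
  rw [← div_le_iff₀ (by positivity)]
  refine le_trans (le_of_eq ?_) h
  rw [Finset.sum_div]
  refine Finset.sum_congr rfl fun i _ => ?_
  rw [Finset.sum_div]
  refine Finset.sum_congr rfl fun t _ => ?_
  field_simp

/-- Independence factorizes the average into hyperbolic cosines, and `cosh x ≤ exp (x² / 2)`. -/
lemma signAvg_exp_le {ι : Type*} [Fintype ι] [DecidableEq ι] (a : ι → ℝ) :
    signAvg (fun σ => Real.exp (∑ i, boolSign (σ i) * a i)) ≤ Real.exp ((∑ i, a i ^ 2) / 2) := by
  have e : ∑ σ : ι → Bool, Real.exp (∑ i, boolSign (σ i) * a i) = ∏ i, 2 * Real.cosh (a i) := by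
    simp only [Real.exp_sum]
    rw [← Fintype.prod_sum (f := fun i b => Real.exp (boolSign b * a i))]
    refine Finset.prod_congr rfl fun i _ => ?_
    rw [Real.cosh_eq]; simp [boolSign]; ring
  rw [signAvg, e, Finset.prod_mul_distrib, Finset.prod_const, Finset.card_univ,
    inv_mul_cancel_left₀ (by positivity), Finset.sum_div, Real.exp_sum]
  exact Finset.prod_le_prod (fun i _ => (Real.cosh_pos _).le) fun i _ => Real.cosh_le_exp_half_sq _

lemma signAvg_sum {ι α : Type*} [Fintype ι] [DecidableEq ι] (s : Finset α)
    (f : α → (ι → Bool) → ℝ) :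
    signAvg (fun σ => ∑ a ∈ s, f a σ) = ∑ a ∈ s, signAvg (f a) := by
  simp only [signAvg, ← Finset.mul_sum]; rw [Finset.sum_comm]

/-- The average operator norm of a Rademacher matrix is of order `√(N + T)`. -/
theorem signAvg_gridMax_le (hN : 0 < N) (hT : 0 < T) :
    signAvg (fun σ : Fin N × Fin T → Bool =>
      gridMax (Matrix.of fun i t => boolSign (σ (i, t)))) ≤ 13 * Real.sqrt (N + T) := by
  have hN' : (0 : ℝ) < N := by exact_mod_cast hN
  have hT' : (1 : ℝ) ≤ T := by exact_mod_cast hT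
  obtain ⟨l, hl⟩ : ∃ l, l = Real.sqrt ((N : ℝ) + T) := ⟨_, rfl⟩
  have hl2 : l ^ 2 = N + T := by rw [hl, Real.sq_sqrt (by positivity)]
  have hl0 : 0 < l := by rw [hl]; exact Real.sqrt_pos.2 (by positivity)
  let c : (Fin N → ℤ) × (Fin T → ℤ) → Fin N × Fin T → ℝ := fun p x =>
    (p.1 x.1 / (3 * Real.sqrt N)) * (p.2 x.2 / (3 * Real.sqrt T))
  let S := intGrid N ×ˢ intGrid T
  have hc : ∀ p ∈ S, ∑ x, c p x ^ 2 ≤ 1 := fun p hp => by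
    have hp := Finset.mem_product.1 hp
    have h1 : (∑ i, (p.1 i : ℝ) ^ 2) ≤ 9 * N := by exact_mod_cast mem_intGrid.1 hp.1
    have h2 : (∑ i, (p.2 i : ℝ) ^ 2) ≤ 9 * T := by exact_mod_cast mem_intGrid.1 hp.2
    calc _ = ((∑ i, (p.1 i : ℝ) ^ 2) / (9 * N)) * ((∑ i, (p.2 i : ℝ) ^ 2) / (9 * T)) := by
          rw [Fintype.sum_prod_type, Finset.sum_div, Finset.sum_div, Finset.sum_mul_sum]
          refine Finset.sum_congr rfl fun i _ => Finset.sum_congr rfl fun t _ => ?_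
          simp only [c]
          rw [mul_pow, div_pow, div_pow, mul_pow, mul_pow, Real.sq_sqrt hN'.le,
            Real.sq_sqrt (by positivity)]
          norm_num
      _ ≤ 1 * 1 := by
          gcongr
          · rw [div_le_one (by positivity)]; exact h1
          · rw [div_le_one (by positivity)]; exact h2
      _ = 1 := one_mul 1
  -- From `x ≤ c + exp (x - c)` with `c = 12 * l ^ 2`: the exponential sum then averages to at most
  -- `1`, since the entropy `11 * l ^ 2` and the variance term `l ^ 2 / 2` stay below `c`. The
  -- result `12 * l ^ 2 + 1` is at most `13 * l ^ 2`.
  have hpt : ∀ σ : Fin N × Fin T → Bool, l * gridMax (Matrix.of fun i t => boolSign (σ (i, t)))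
      ≤ 12 * l ^ 2 + ∑ p ∈ S, Real.exp (-(12 * l ^ 2))
        * Real.exp (∑ x, boolSign (σ x) * (l * c p x)) := fun σ => by
    obtain ⟨p, hp, he⟩ := Finset.exists_mem_eq_sup' (s := S)
      ⟨(0, 0), by simp [S, Finset.mem_product, mem_intGrid]⟩
      (fun p => ∑ i, ∑ t, (Matrix.of fun i t => boolSign (σ (i, t))) i t *
        ((p.1 i / (3 * Real.sqrt N)) * (p.2 t / (3 * Real.sqrt T))))
    have he' : l * gridMax (Matrix.of fun i t => boolSign (σ (i, t)))
        = ∑ x, boolSign (σ x) * (l * c p x) := by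
      rw [gridMax, he, Fintype.sum_prod_type, Finset.mul_sum]
      refine Finset.sum_congr rfl fun i _ => ?_
      rw [Finset.mul_sum]
      refine Finset.sum_congr rfl fun t _ => ?_
      simp only [c, Matrix.of_apply]; ring
    have h1 := Finset.single_le_sum (f := fun p => Real.exp (-(12 * l ^ 2))
      * Real.exp (∑ x, boolSign (σ x) * (l * c p x))) (fun _ _ => by positivity) hp
    rw [he']
    refine le_trans ?_ (add_le_add_right h1 _)
    rw [← Real.exp_add]
    linarith [Real.add_one_le_exp (-(12 * l ^ 2) + ∑ x, boolSign (σ x) * (l * c p x))]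
  have hmain := signAvg_mono hpt
  rw [signAvg_const_mul, signAvg_add, signAvg_const, signAvg_sum] at hmain
  have hsum : ∑ p ∈ S, signAvg (fun σ : Fin N × Fin T → Bool => Real.exp (-(12 * l ^ 2))
      * Real.exp (∑ x, boolSign (σ x) * (l * c p x))) ≤ 1 := by
    calc _ ≤ ∑ p ∈ S, Real.exp (-(12 * l ^ 2)) * Real.exp (l ^ 2 / 2) := by
          refine Finset.sum_le_sum fun p hp => ?_
          rw [signAvg_const_mul]
          gcongr
          refine (signAvg_exp_le _).trans (Real.exp_le_exp.2 ?_)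
          simp only [mul_pow, ← Finset.mul_sum]
          nlinarith [hc p hp, sq_nonneg l]
      _ = ((intGrid N).card * (intGrid T).card : ℝ)
            * (Real.exp (-(12 * l ^ 2)) * Real.exp (l ^ 2 / 2)) := by
          simp [S, Finset.card_product]
      _ ≤ (Real.exp (11 * N) * Real.exp (11 * T))
            * (Real.exp (-(12 * l ^ 2)) * Real.exp (l ^ 2 / 2)) := by
          gcongr <;> exact card_intGrid_le _
      _ ≤ 1 := by
          rw [← Real.exp_add, ← Real.exp_add, ← Real.exp_add, Real.exp_le_one_iff]
          nlinarith
  rw [← hl]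
  have : l * signAvg (fun σ : Fin N × Fin T → Bool =>
      gridMax (Matrix.of fun i t => boolSign (σ (i, t)))) ≤ l * (13 * l) := by nlinarith
  exact le_of_mul_le_mul_left this hl0

end Grid

/-! ### The check function and quadratic growth of its expectation. -/

section CheckFunction

lemma checkFn_eq_max (τ e : ℝ) : checkFn τ e = max (τ * e) ((τ - 1) * e) := by
  unfold checkFn
  split_ifs with h
  · rw [max_eq_right]; nlinarith
  · rw [max_eq_left]
    · ring
    · nlinarith

/-- The increment `ρ_τ(x - d) - ρ_τ(x)` of the check function. -/
noncomputable def checkInc (τ x d : ℝ) : ℝ := checkFn τ (x - d) - checkFn τ x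

lemma checkInc_zero (τ x : ℝ) : checkInc τ x 0 = 0 := by simp [checkInc]

lemma measurable_checkInc (τ d : ℝ) : Measurable fun x => checkInc τ x d := by
  simp only [checkInc, checkFn_eq_max]
  fun_prop

variable {τ : ℝ}

lemma abs_checkInc_sub_le (h0 : 0 < τ) (h1 : τ < 1) (x y z : ℝ) :
    |checkInc τ x y - checkInc τ x z| ≤ |y - z| := by
  simp only [checkInc, checkFn_eq_max, sub_sub_sub_cancel_right]
  refine (abs_max_sub_max_le_max _ _ _ _).trans (max_le ?_ ?_)
  · rw [show τ * (x - y) - τ * (x - z) = τ * -(y - z) by ring, abs_mul, abs_neg, abs_of_pos h0]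
    exact mul_le_of_le_one_left (abs_nonneg _) h1.le
  · rw [show (τ - 1) * (x - y) - (τ - 1) * (x - z) = (1 - τ) * (y - z) by ring, abs_mul,
      abs_of_pos (by linarith)]
    exact mul_le_of_le_one_left (abs_nonneg _) (by linarith)

/-- Convexity of the check function, as a maximum of two linear functions, together with the
vanishing of the increment at `0`. -/
lemma checkInc_mul_le {s : ℝ} (hs0 : 0 ≤ s) (hs1 : s ≤ 1) (x d : ℝ) :
    checkInc τ x (s * d) ≤ s * checkInc τ x d := by
  simp only [checkInc, checkFn_eq_max]
  have a1 := le_max_left (τ * (x - d)) ((τ - 1) * (x - d))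
  have a2 := le_max_right (τ * (x - d)) ((τ - 1) * (x - d))
  have b1 := le_max_left (τ * x) ((τ - 1) * x)
  have b2 := le_max_right (τ * x) ((τ - 1) * x)
  have : max (τ * (x - s * d)) ((τ - 1) * (x - s * d))
      ≤ s * max (τ * (x - d)) ((τ - 1) * (x - d)) + (1 - s) * max (τ * x) ((τ - 1) * x) := by
    refine max_le ?_ ?_
    · nlinarith [mul_le_mul_of_nonneg_left a1 hs0,
        mul_le_mul_of_nonneg_left b1 (by linarith : 0 ≤ 1 - s)]
    · nlinarith [mul_le_mul_of_nonneg_left a2 hs0,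
        mul_le_mul_of_nonneg_left b2 (by linarith : 0 ≤ 1 - s)]
  linarith

/-- This is Knight's identity for `d ≥ 0`, keeping only the part of its integral over `[d/2, d]`.
The first two terms will have mean zero when `0` is the `τ`-quantile. -/
lemma checkInc_lower_right (d x : ℝ) :
    -d * τ + d * (Set.Iic 0).indicator 1 x + d / 2 * (Set.Ioc 0 (d / 2)).indicator 1 x
      ≤ checkInc τ x d := by
  simp only [checkInc, checkFn_eq_max, Set.indicator_apply, Set.mem_Iic, Set.mem_Ioc, Pi.one_apply]
  have a1 := le_max_left (τ * (x - d)) ((τ - 1) * (x - d))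
  have a2 := le_max_right (τ * (x - d)) ((τ - 1) * (x - d))
  rcases le_or_gt x 0 with hx | hx
  · rw [max_eq_right (b := (τ - 1) * x) (by nlinarith)]
    simp only [hx, not_lt.2 hx, if_true, false_and, if_false]
    linarith
  · rw [max_eq_left (a := τ * x) (by nlinarith)]
    simp only [hx, not_le.2 hx, true_and, if_false]
    split_ifs <;> linarith

lemma checkInc_lower_left (d x : ℝ) :
    -d * τ + d * (Set.Iic 0).indicator 1 x + -d / 2 * (Set.Ioc (d / 2) 0).indicator 1 x
      ≤ checkInc τ x d := by
  simp only [checkInc, checkFn_eq_max, Set.indicator_apply, Set.mem_Iic, Set.mem_Ioc, Pi.one_apply]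
  have a1 := le_max_left (τ * (x - d)) ((τ - 1) * (x - d))
  have a2 := le_max_right (τ * (x - d)) ((τ - 1) * (x - d))
  rcases le_or_gt x 0 with hx | hx
  · rw [max_eq_right (b := (τ - 1) * x) (by nlinarith)]
    simp only [hx, and_true, if_true]
    split_ifs <;> linarith
  · rw [max_eq_left (a := τ * x) (by nlinarith)]
    simp only [not_le.2 hx, and_false, if_false]
    linarith

/-- The expected check loss grows quadratically around the `τ`-quantile `0` if the distribution
puts mass proportional to the length on intervals adjacent to `0`. -/
lemma sq_le_integral_checkInc (h0 : 0 < τ) (h1 : τ < 1) {μ : Measure ℝ} [IsProbabilityMeasure μ]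
    {a B : ℝ} (hμ : μ.real (Set.Iic 0) = τ)
    (hpos : ∀ y, 0 ≤ y → y ≤ B → a * y ≤ μ.real (Set.Ioc 0 y))
    (hneg : ∀ y, 0 ≤ y → y ≤ B → a * y ≤ μ.real (Set.Ioc (-y) 0)) {d : ℝ} (hd : |d| ≤ B) :
    a / 4 * d ^ 2 ≤ ∫ x, checkInc τ x d ∂μ := by
  have hint : Integrable (fun x => checkInc τ x d) μ :=
    Integrable.of_bound (measurable_checkInc τ d).aestronglyMeasurable |d| (ae_of_all _ fun x => by
      simpa [checkInc_zero] using abs_checkInc_sub_le h0 h1 x d 0)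
  have hlow : ∀ (J : Set ℝ), MeasurableSet J → ∀ e : ℝ, (∀ x, -d * τ + d * (Set.Iic 0).indicator 1 x
      + e * J.indicator 1 x ≤ checkInc τ x d) → e * μ.real J ≤ ∫ x, checkInc τ x d ∂μ := by
    intro J hJ e h
    have i1 : Integrable ((Set.Iic (0 : ℝ)).indicator (1 : ℝ → ℝ)) μ :=
      (integrable_const (1 : ℝ)).indicator measurableSet_Iic
    have i2 : Integrable (J.indicator (1 : ℝ → ℝ)) μ := (integrable_const (1 : ℝ)).indicator hJ
    have i3 : Integrable (fun x => -d * τ + d * (Set.Iic 0).indicator 1 x) μ :=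
      (integrable_const _).add (i1.const_mul d)
    have e1 : ∫ x, (-d * τ + d * (Set.Iic 0).indicator 1 x + e * J.indicator 1 x) ∂μ
        = e * μ.real J := by
      rw [integral_add i3 (i2.const_mul e), integral_add (integrable_const _) (i1.const_mul d),
        integral_const_mul d, integral_const_mul e, integral_indicator_one measurableSet_Iic,
        integral_indicator_one hJ, hμ]
      simp
    rw [← e1]
    exact integral_mono (i3.add (i2.const_mul e)) hint h
  have habs := abs_nonneg d
  rcases le_total 0 d with h | h
  · rw [abs_of_nonneg h] at hd
    have := hlow _ measurableSet_Ioc (d / 2) (checkInc_lower_right d)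
    have h3 := hpos (d / 2) (by linarith) (by linarith)
    nlinarith
  · rw [abs_of_nonpos h] at hd
    have := hlow _ measurableSet_Ioc (-d / 2) (checkInc_lower_left d)
    have h3 := hneg (-(d / 2)) (by linarith) (by linarith)
    rw [neg_neg] at h3
    nlinarith

/-- Strictly below the infimum the distribution function is less than `τ`, and without atoms this
passes to the point itself. The reverse inequality is right-continuity. -/
lemma measureReal_Iic_quantile (h0 : 0 < τ) (h1 : τ < 1) (μ : Measure ℝ) [IsProbabilityMeasure μ]
    [NullSingletonClass μ] : μ.real (Set.Iic (quantile μ τ)) = τ := by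
  set S := {x | τ ≤ cdf μ x} with hS
  have hne : S.Nonempty := ((tendsto_cdf_atTop μ).eventually (eventually_ge_nhds h1)).exists
  have hbdd : BddBelow S := by
    obtain ⟨b, hb⟩ := ((tendsto_cdf_atBot μ).eventually (eventually_lt_nhds h0)).exists
    refine ⟨b, fun x hx => ?_⟩
    by_contra hlt
    exact absurd ((monotone_cdf μ) (not_le.1 hlt).le) (not_le.2 (hb.trans_le hx))
  rw [← cdf_eq_real]
  refine le_antisymm ?_ ?_
  · rw [cdf_eq_real, ← measureReal_congr (Iio_ae_eq_Iic (μ := μ) (a := quantile μ τ))]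
    have hlim : Tendsto (fun n : ℕ => μ.real (Set.Iic (quantile μ τ - 1 / ((n : ℝ) + 1)))) atTop
        (𝓝 (μ.real (Set.Iio (quantile μ τ)))) := by
      have hU : ⋃ n : ℕ, Set.Iic (quantile μ τ - 1 / ((n : ℝ) + 1)) = Set.Iio (quantile μ τ) := by
        ext x
        simp only [Set.mem_iUnion, Set.mem_Iic, Set.mem_Iio]
        constructor
        · rintro ⟨n, hn⟩
          have : (0 : ℝ) < 1 / ((n : ℝ) + 1) := by positivity
          linarith
        · intro hx
          obtain ⟨n, hn⟩ := exists_nat_one_div_lt (sub_pos.2 hx)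
          exact ⟨n, by linarith⟩
      rw [← hU]
      refine (ENNReal.tendsto_toReal (measure_ne_top _ _)).comp
        (tendsto_measure_iUnion_atTop fun m n hmn => Set.Iic_subset_Iic.2 ?_)
      have : (1 : ℝ) / ((n : ℝ) + 1) ≤ 1 / ((m : ℝ) + 1) := by
        have : (m : ℝ) ≤ n := by exact_mod_cast hmn
        gcongr
      linarith
    refine le_of_tendsto' hlim fun n => ?_
    rw [← cdf_eq_real]
    by_contra hlt
    have hmem : quantile μ τ - 1 / ((n : ℝ) + 1) ∈ S := (not_le.1 hlt).le
    have := csInf_le hbdd hmem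
    have hp : (0 : ℝ) < 1 / ((n : ℝ) + 1) := by positivity
    change quantile μ τ ≤ _ at this
    linarith
  · have hcont := (cdf μ).right_continuous (quantile μ τ)
    have hlim : Tendsto (cdf μ) (𝓝[>] quantile μ τ) (𝓝 (cdf μ (quantile μ τ))) :=
      hcont.mono_left (nhdsWithin_mono _ Set.Ioi_subset_Ici_self)
    refine ge_of_tendsto hlim ?_
    filter_upwards [self_mem_nhdsWithin] with x hx
    obtain ⟨y, hy, hyx⟩ := exists_lt_of_csInf_lt hne (show sInf S < x from hx)
    exact le_trans hy ((monotone_cdf μ) hyx.le)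

lemma mul_length_le_measureReal_Ioc {h : ℝ → ℝ} {μ : Measure ℝ} [IsProbabilityMeasure μ]
    (hμ : μ = volume.withDensity fun x => ENNReal.ofReal (h x)) {a x y : ℝ} (ha : 0 ≤ a)
    (hh : ∀ z ∈ Set.Icc x y, a ≤ h z) : a * (y - x) ≤ μ.real (Set.Ioc x y) := by
  have h1 : ENNReal.ofReal (a * (y - x)) ≤ μ (Set.Ioc x y) := by
    rw [hμ, withDensity_apply _ measurableSet_Ioc, ENNReal.ofReal_mul ha, ← Real.volume_Ioc,
      ← setLIntegral_const]
    exact setLIntegral_mono' measurableSet_Ioc fun z hz =>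
      ENNReal.ofReal_le_ofReal (hh z ⟨hz.1.le, hz.2⟩)
  rw [measureReal_def]
  exact (ENNReal.ofReal_le_iff_le_toReal (measure_ne_top _ _)).1 h1

/-- Quadratic growth of the expected check loss around a quantile, for a variable with a density
that is bounded below. -/
theorem sq_le_integral_checkInc_error {Ω : Type*} [MeasurableSpace Ω] {P : Measure Ω}
    [IsProbabilityMeasure P] (h0 : 0 < τ) (h1 : τ < 1) {X : Ω → ℝ} (hX : Measurable X)
    {h : ℝ → ℝ} (hdens : P.map X = volume.withDensity fun x => ENNReal.ofReal (h x))
    {c a B R : ℝ} (hq : quantile (P.map X) τ = c) (ha : 0 ≤ a) (hcR : |c| + B ≤ R)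
    (hlow : ∀ x ∈ Set.Icc (-R) R, a ≤ h x) {d : ℝ} (hd : |d| ≤ B) :
    a / 4 * d ^ 2 ≤ ∫ x, checkInc τ x d ∂(P.map fun ω => X ω - c) := by
  have hXc : Measurable fun ω => X ω - c := hX.sub_const c
  have p1 : IsProbabilityMeasure (P.map X) := Measure.isProbabilityMeasure_map hX.aemeasurable
  have p2 : IsProbabilityMeasure (P.map fun ω => X ω - c) :=
    Measure.isProbabilityMeasure_map hXc.aemeasurable
  have na : NullSingletonClass (P.map X) := by rw [hdens]; infer_instance
  have key : ∀ S : Set ℝ, MeasurableSet S →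
      (P.map fun ω => X ω - c).real S = (P.map X).real ((fun x => x - c) ⁻¹' S) := fun S hS => by
    rw [map_measureReal_apply hXc hS,
      map_measureReal_apply hX (show MeasurableSet ((fun x => x - c) ⁻¹' S) from
        (measurable_id.sub_const c) hS)]
    rfl
  have hc := abs_le.1 (le_refl |c|)
  refine sq_le_integral_checkInc h0 h1 ?_ ?_ ?_ hd
  · rw [key _ measurableSet_Iic, Set.preimage_sub_const_Iic, zero_add, ← hq]
    exact measureReal_Iic_quantile h0 h1 _
  · intro y hy0 hy
    rw [key _ measurableSet_Ioc, Set.preimage_sub_const_Ioc]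
    have := mul_length_le_measureReal_Ioc hdens ha (x := 0 + c) (y := y + c)
      fun z hz => hlow z ⟨by linarith [hz.1], by linarith [hz.2]⟩
    linarith
  · intro y hy0 hy
    rw [key _ measurableSet_Ioc, Set.preimage_sub_const_Ioc]
    have := mul_length_le_measureReal_Ioc hdens ha (x := -y + c) (y := 0 + c)
      fun z hz => hlow z ⟨by linarith [hz.1], by linarith [hz.2]⟩
    linarith

end CheckFunction

/-! ### Rate for the common components. -/

section CommonComponents

variable {Ω : Type*} [MeasurableSpace Ω] {P : Measure Ω} [IsProbabilityMeasure P]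

/-- Arrays of rank at most `2r` and Frobenius norm at most `ϱ`. -/
def lowRankBall (N T r : ℕ) (ϱ : ℝ) : Set (Fin N × Fin T → ℝ) :=
  {d | ∃ (G : Matrix (Fin N) (Fin r ⊕ Fin r) ℝ) (H : Matrix (Fin T) (Fin r ⊕ Fin r) ℝ),
    (∀ x, d x = (G * Hᵀ) x.1 x.2) ∧ ‖G * Hᵀ‖ ≤ ϱ}

lemma isBounded_lowRankBall (N T r : ℕ) (ϱ : ℝ) :
    Bornology.IsBounded (lowRankBall N T r ϱ) := by
  refine (Metric.isBounded_iff_subset_closedBall 0).2 ⟨max ϱ 0, ?_⟩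
  rintro d ⟨G, H, hd, hn⟩
  rw [mem_closedBall_zero_iff, pi_norm_le_iff_of_nonneg (le_max_right _ _)]
  intro x
  rw [hd, Real.norm_eq_abs]
  exact ((abs_entry_le_frobenius_norm _ _ _).trans hn).trans (le_max_left _ _)

/-- Uniform deviation bound for the centred check-loss process over low-rank arrays. -/
lemma measure_lowRank_deviation_le {N T : ℕ} (hN : 0 < N) (hT : 0 < T) (r : ℕ) {τ : ℝ}
    (hτ0 : 0 < τ) (hτ1 : τ < 1) {U : Fin N × Fin T → Ω → ℝ} (hU : ∀ x, Measurable (U x))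
    (hind : iIndepFun U P) {ϱ η : ℝ} (hϱ : 0 ≤ ϱ) (hη : 0 < η) :
    P {ω | ∃ d ∈ lowRankBall N T r ϱ, η ≤ ∑ x, (∫ y, checkInc τ y (d x) ∂(P.map (U x))
        - checkInc τ (U x ω) (d x))}
      ≤ ENNReal.ofReal (156 * Real.sqrt (2 * r) * ϱ * Real.sqrt (N + T) / η) := by
  refine (measure_deviation_le hU hind (g := fun _ y d => checkInc τ y d)
    (fun _ d => measurable_checkInc τ d) (fun _ => abs_checkInc_sub_le hτ0 hτ1)
    (fun _ => checkInc_zero τ) (isBounded_lowRankBall N T r ϱ) ⟨0, 0, by simp, by simpa using hϱ⟩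
    (q := fun σ => (3 * (Real.sqrt (2 * r) * ϱ))
      * gridMax (Matrix.of fun i t => boolSign (σ (i, t)))) ?_ hη).trans ?_
  · rintro σ d ⟨G, H, hd, hn⟩
    have h := sum_mul_le_of_lowRank
      (mul_nonneg (by norm_num : (0 : ℝ) ≤ 3) (gridMax_nonneg _))
      (bilin_le_gridMax_mul hN hT (Matrix.of fun i t => boolSign (σ (i, t)))) G H
    rw [Fintype.sum_prod_type]
    simp only [Matrix.of_apply, Fintype.card_sum, Fintype.card_fin] at h
    simp only [hd]
    refine h.trans ?_
    have hg := gridMax_nonneg (Matrix.of fun (i : Fin N) (t : Fin T) => boolSign (σ (i, t)))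
    calc _ ≤ 3 * gridMax (Matrix.of fun (i : Fin N) (t : Fin T) => boolSign (σ (i, t)))
          * (Real.sqrt (2 * r) * ϱ) := by
          rw [show ((r + r : ℕ) : ℝ) = 2 * r by push_cast; ring]; gcongr
      _ = _ := by ring
  · refine ENNReal.ofReal_le_ofReal ?_
    rw [signAvg_const_mul]
    have := signAvg_gridMax_le hN hT
    -- The constant is `156 = 4 * 3 * 13`: symmetrization with Markov, grid approximation, and the
    -- average grid maximum.
    calc _ ≤ 4 * (3 * (Real.sqrt (2 * r) * ϱ) * (13 * Real.sqrt (N + T))) / η := by gcongr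
      _ = _ := by ring

variable {K r N T : ℕ}

/-- The error `Λ_k Fᵀ - Λ⁰_k F⁰ᵀ` of the `k`-th common component. -/
def commonError (θ θ₀ : Params K r N T) (k : Fin K) : Matrix (Fin N) (Fin T) ℝ :=
  θ.loading k * θ.factorᵀ - θ₀.loading k * θ₀.factorᵀ

lemma commonError_apply (θ θ₀ : Params K r N T) (k : Fin K) (i : Fin N) (t : Fin T) :
    commonError θ θ₀ k i t = θ.common k i t - θ₀.common k i t := rfl

/-- Concatenating the two factorizations gives rank at most `2r`. No normalization is imposed, so
the scaled error need not come from a parameter in the parameter space. -/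
lemma smul_commonError_mem {θ θ₀ : Params K r N T} {k : Fin K} {s ϱ : ℝ}
    (h : ‖s • commonError θ θ₀ k‖ ≤ ϱ) :
    (fun x => s * commonError θ θ₀ k x.1 x.2) ∈ lowRankBall N T r ϱ := by
  have e : (Matrix.fromCols (s • θ.loading k) (-s • θ₀.loading k))
      * (Matrix.fromCols θ.factor θ₀.factor)ᵀ = s • commonError θ θ₀ k := by
    rw [Matrix.transpose_fromCols, Matrix.fromCols_mul_fromRows, commonError, smul_sub,
      Matrix.smul_mul, Matrix.smul_mul, neg_smul, sub_eq_add_neg]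
  refine ⟨_, _, fun x => ?_, e ▸ h⟩
  rw [e]; rfl

/-- If the check-loss process does not deviate on low-rank arrays of norm `ϱ`, a parameter that does
not increase the objective has common components within distance `ϱ` of the truth. The proof scales
the error down to norm `ϱ` and uses convexity of the loss. -/
lemma sum_norm_commonError_le {w τ : Fin K → ℝ} (hN : 0 < N) (hT : 0 < T) (hw : ∀ k, 0 < w k)
    {x : Fin N → Fin T → ℝ} {θ θ₀ : Params K r N T} {m : Fin K → Fin N × Fin T → ℝ → ℝ}
    {a B wmin ϱ η : ℝ} (hB : ∀ k i t, |commonError θ θ₀ k i t| ≤ B) (ha : 0 ≤ a)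
    (hwmin : ∀ k, wmin ≤ w k)
    (hm : ∀ k p d, |d| ≤ B → a * d ^ 2 ≤ m k p d) (hϱ : 0 < ϱ)
    (hobj : objective w τ x θ ≤ objective w τ x θ₀)
    (hη : (∑ k, w k) * η ≤ wmin * a * ϱ ^ 2)
    (hdev : ∀ k, ∀ d ∈ lowRankBall N T r ϱ,
      ∑ p, (m k p (d p) - checkInc (τ k) (x p.1 p.2 - θ₀.common k p.1 p.2) (d p)) < η) :
    ∑ k, ‖commonError θ θ₀ k‖ ^ 2 ≤ ϱ ^ 2 := by
  by_contra! hlt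
  set S := ∑ k, ‖commonError θ θ₀ k‖ ^ 2 with hS
  have hS0 : 0 < S := lt_trans (by positivity) hlt
  have hK : Nonempty (Fin K) := by
    by_contra hK
    rw [not_nonempty_iff] at hK
    simp [hS] at hS0
  obtain ⟨s, hs⟩ : ∃ s, s = ϱ / Real.sqrt S := ⟨_, rfl⟩
  have hsS : 0 < Real.sqrt S := Real.sqrt_pos.2 hS0
  have hs0 : 0 < s := by rw [hs]; positivity
  have hs1 : s ≤ 1 := by
    rw [hs, div_le_one hsS]; exact Real.le_sqrt_of_sq_le hlt.le
  have hs2 : s ^ 2 * S = ϱ ^ 2 := by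
    rw [hs, div_pow, Real.sq_sqrt hS0.le]; field_simp
  have hmem : ∀ k, (fun p => s * commonError θ θ₀ k p.1 p.2) ∈ lowRankBall N T r ϱ := fun k => by
    refine smul_commonError_mem (abs_le_of_sq_le_sq' ?_ hϱ.le).2
    rw [norm_smul, mul_pow, Real.norm_eq_abs, sq_abs, ← hs2]
    gcongr
    exact Finset.single_le_sum (f := fun k => ‖commonError θ θ₀ k‖ ^ 2) (fun _ _ => sq_nonneg _)
      (Finset.mem_univ k)
  let u : Fin K → Fin N × Fin T → ℝ := fun k p => x p.1 p.2 - θ₀.common k p.1 p.2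
  have hobj' : ∑ k, w k * ∑ p : Fin N × Fin T,
      checkInc (τ k) (u k p) (commonError θ θ₀ k p.1 p.2) ≤ 0 := by
    have hpos : 0 < ((N : ℝ) * T)⁻¹ := by
      have : (0 : ℝ) < N := by exact_mod_cast hN
      have : (0 : ℝ) < T := by exact_mod_cast hT
      positivity
    have h1 := le_of_mul_le_mul_left hobj hpos
    rw [← sub_nonpos, ← Finset.sum_sub_distrib] at h1
    refine le_trans (le_of_eq ?_) h1
    refine Finset.sum_congr rfl fun k _ => ?_
    rw [Fintype.sum_prod_type, Finset.mul_sum, ← Finset.sum_sub_distrib]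
    refine Finset.sum_congr rfl fun i _ => ?_
    rw [Finset.mul_sum, ← Finset.sum_sub_distrib]
    refine Finset.sum_congr rfl fun t _ => ?_
    simp only [checkInc, commonError_apply, u]
    rw [show x i t - θ₀.common k i t - (θ.common k i t - θ₀.common k i t)
      = x i t - θ.common k i t by ring]
    ring
  have hscaled : ∑ k, w k * ∑ p : Fin N × Fin T,
      checkInc (τ k) (u k p) (s * commonError θ θ₀ k p.1 p.2) ≤ 0 := by
    calc _ ≤ ∑ k, w k * ∑ p : Fin N × Fin T,
          s * checkInc (τ k) (u k p) (commonError θ θ₀ k p.1 p.2) := by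
          refine Finset.sum_le_sum fun k _ => mul_le_mul_of_nonneg_left
            (Finset.sum_le_sum fun p _ => checkInc_mul_le hs0.le hs1 _ _) (hw k).le
      _ = s * ∑ k, w k * ∑ p : Fin N × Fin T,
          checkInc (τ k) (u k p) (commonError θ θ₀ k p.1 p.2) := by
          rw [Finset.mul_sum]
          refine Finset.sum_congr rfl fun k _ => ?_
          rw [← Finset.mul_sum]; ring
      _ ≤ 0 := mul_nonpos_of_nonneg_of_nonpos hs0.le hobj'
  have hquad : wmin * a * ϱ ^ 2 ≤ ∑ k, w k * ∑ p : Fin N × Fin T,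
      m k p (s * commonError θ θ₀ k p.1 p.2) := by
    rw [← hs2, hS, Finset.mul_sum, Finset.mul_sum]
    refine Finset.sum_le_sum fun k _ => ?_
    calc wmin * a * (s ^ 2 * ‖commonError θ θ₀ k‖ ^ 2)
        ≤ w k * a * (s ^ 2 * ‖commonError θ θ₀ k‖ ^ 2) := by gcongr; exact hwmin k
      _ = w k * ∑ p : Fin N × Fin T, a * (s * commonError θ θ₀ k p.1 p.2) ^ 2 := by
          rw [frobenius_norm_sq, Fintype.sum_prod_type]
          simp only [mul_pow, ← Finset.mul_sum]
          ring
      _ ≤ _ := by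
          refine mul_le_mul_of_nonneg_left (Finset.sum_le_sum fun p _ => hm k p _ ?_) (hw k).le
          rw [abs_mul, abs_of_pos hs0]
          exact (mul_le_of_le_one_left (abs_nonneg _) hs1).trans (hB k p.1 p.2)
  -- The expected loss is at least `wmin * a * ϱ ^ 2` and the observed loss is at most `0`, so the
  -- deviation would have to reach `(∑ k, w k) * η`.
  have hdev' : ∑ k, w k * ∑ p : Fin N × Fin T, (m k p (s * commonError θ θ₀ k p.1 p.2)
      - checkInc (τ k) (u k p) (s * commonError θ θ₀ k p.1 p.2)) < ∑ k, w k * η :=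
    Finset.sum_lt_sum_of_nonempty Finset.univ_nonempty fun k _ =>
      mul_lt_mul_of_pos_left (hdev k _ (hmem k)) (hw k)
  simp only [Finset.sum_sub_distrib, mul_sub] at hdev'
  rw [← Finset.sum_mul] at hdev'
  linarith

end CommonComponents

/-! ### From common components to factors and loadings. -/

section Rates

variable {K r N T : ℕ}

lemma gram_eq_transpose_mul {n : ℕ} (A : Matrix (Fin n) (Fin r) ℝ) :
    gram A = ((Real.sqrt n)⁻¹ • A)ᵀ * ((Real.sqrt n)⁻¹ • A) := by
  rw [Matrix.transpose_smul, Matrix.smul_mul, Matrix.mul_smul, smul_smul, gram, ← mul_inv,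
    Real.mul_self_sqrt (Nat.cast_nonneg n)]

lemma norm_inv_sqrt_smul {n : ℕ} (A : Matrix (Fin n) (Fin r) ℝ) :
    ‖(Real.sqrt n)⁻¹ • A‖ = ‖A‖ / Real.sqrt n := by
  rw [norm_smul, norm_inv, Real.norm_of_nonneg (Real.sqrt_nonneg _), div_eq_inv_mul]

lemma norm_inv_sqrt_smul_le {n : ℕ} {A : Matrix (Fin n) (Fin r) ℝ} {b : ℝ} (hn : 0 < n)
    (hb : 0 ≤ b) (hA : ∀ i j, |A i j| ≤ b) : ‖(Real.sqrt n)⁻¹ • A‖ ≤ Real.sqrt r * b := by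
  have hn' : (0 : ℝ) < n := by exact_mod_cast hn
  rw [norm_inv_sqrt_smul, div_le_iff₀ (Real.sqrt_pos.2 hn')]
  refine le_of_sq_le_sq ?_ (by positivity)
  rw [mul_pow, mul_pow, Real.sq_sqrt (Nat.cast_nonneg _), Real.sq_sqrt hn'.le, frobenius_norm_sq]
  calc _ ≤ ∑ _i : Fin n, ∑ _j : Fin r, b ^ 2 :=
        Finset.sum_le_sum fun i _ => Finset.sum_le_sum fun j _ => by
          rw [← sq_abs]; gcongr; exact hA i j
    _ = r * b ^ 2 * n := by simp; ring

/-- Closeness of the common components implies closeness of sign-aligned factors and loadings. -/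
theorem exists_alignment_bound (r : ℕ) {b g : ℝ} (hb : 0 ≤ b) (hg : 0 < g) :
    ∃ C > 0, ∃ δ₀ > 0, ∀ {K N T : ℕ} {kstar : Fin K} {θ θ₀ : Params K r N T} {δ : ℝ},
      0 < N → 0 < T → gram θ.factor = 1 → gram θ₀.factor = 1 →
      (gram (θ.loading kstar)).IsDiag → Antitone (gram (θ.loading kstar)).diag →
      (gram (θ₀.loading kstar)).IsDiag → (∀ j, g ≤ gram (θ₀.loading kstar) j j) →
      (∀ i j, i < j → gram (θ₀.loading kstar) j j + g ≤ gram (θ₀.loading kstar) i i) →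
      (∀ k i j, |θ.loading k i j| ≤ b) → (∀ k i j, |θ₀.loading k i j| ≤ b) →
      (∀ k, ‖commonError θ θ₀ k‖ ≤ δ * (Real.sqrt N * Real.sqrt T)) → δ ≤ δ₀ →
      ‖θ.factor - θ₀.factor * signAlign θ θ₀‖ / Real.sqrt T ≤ C * δ ∧
      ∀ k, ‖θ.loading k - θ₀.loading k * signAlign θ θ₀‖ / Real.sqrt N ≤ C * δ := by
  obtain ⟨C, hC, δ₀, hδ₀, h⟩ := exists_perturbation_bound r
    (mul_nonneg (Real.sqrt_nonneg r) hb) hg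
  refine ⟨C + Real.sqrt r + Real.sqrt r * b * Real.sqrt r * C, by positivity, δ₀, hδ₀, ?_⟩
  intro K N T kstar θ θ₀ δ hN hT hF hF₀ hD hanti hD₀ hg₀ hgap hL hL₀ hE hδ
  have sN : 0 < Real.sqrt N := Real.sqrt_pos.2 (by exact_mod_cast hN)
  have sT : 0 < Real.sqrt T := Real.sqrt_pos.2 (by exact_mod_cast hT)
  have hδ0 : 0 ≤ δ := by
    have := (norm_nonneg _).trans (hE kstar)
    exact nonneg_of_mul_nonneg_left this (by positivity)
  obtain ⟨U, hU⟩ : ∃ U, U = (Real.sqrt T)⁻¹ • θ.factor := ⟨_, rfl⟩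
  obtain ⟨U₀, hU₀⟩ : ∃ U₀, U₀ = (Real.sqrt T)⁻¹ • θ₀.factor := ⟨_, rfl⟩
  let L : Fin K → Matrix (Fin N) (Fin r) ℝ := fun k => (Real.sqrt N)⁻¹ • θ.loading k
  let L₀ : Fin K → Matrix (Fin N) (Fin r) ℝ := fun k => (Real.sqrt N)⁻¹ • θ₀.loading k
  rw [gram_eq_transpose_mul, ← hU] at hF
  rw [gram_eq_transpose_mul, ← hU₀] at hF₀
  rw [gram_eq_transpose_mul] at hD hanti hD₀
  simp only [gram_eq_transpose_mul] at hg₀ hgap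
  have hS : signAlign θ θ₀ = sgnMatrix (Uᵀ * U₀) := by
    rw [signAlign, hU, hU₀, Matrix.transpose_smul, Matrix.smul_mul, Matrix.mul_smul, smul_smul,
      ← mul_inv, Real.mul_self_sqrt (Nat.cast_nonneg T)]
  have nL : ∀ k, ‖L k‖ ≤ Real.sqrt r * b := fun k => norm_inv_sqrt_smul_le hN hb (hL k)
  have nL₀ : ∀ k, ‖L₀ k‖ ≤ Real.sqrt r * b := fun k => norm_inv_sqrt_smul_le hN hb (hL₀ k)
  have hE' : ∀ k, ‖L k * Uᵀ - L₀ k * U₀ᵀ‖ ≤ δ := fun k => by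
    have e : L k * Uᵀ - L₀ k * U₀ᵀ = ((Real.sqrt T)⁻¹ * (Real.sqrt N)⁻¹) • commonError θ θ₀ k := by
      simp only [L, L₀, hU, hU₀, commonError, Matrix.transpose_smul, Matrix.smul_mul,
        Matrix.mul_smul, smul_smul, smul_sub]
    rw [e, norm_smul, Real.norm_of_nonneg (by positivity), ← mul_inv, inv_mul_le_iff₀ (by positivity)]
    linarith [hE k]
  have main := h hF hF₀ hD hanti hD₀ hg₀ hgap (nL kstar) (nL₀ kstar) (hE' kstar) hδ
  rw [← hS] at main
  have extra : 0 ≤ Real.sqrt r * b * Real.sqrt r * C * δ := by positivity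
  have extra2 : 0 ≤ Real.sqrt r * δ := by positivity
  have extra3 : 0 ≤ C * δ := by positivity
  refine ⟨?_, fun k => ?_⟩
  · rw [← norm_inv_sqrt_smul, smul_sub, ← Matrix.smul_mul, ← hU, ← hU₀]
    linarith
  · rw [← norm_inv_sqrt_smul, smul_sub, ← Matrix.smul_mul]
    -- Orthonormality of `U` and `U₀` recovers the loadings from the common components; the second
    -- term carries the factor error. Diagonality is needed only at `kstar`, so this covers every
    -- `k`.
    have e : L k - L₀ k * signAlign θ θ₀
        = (L k * Uᵀ - L₀ k * U₀ᵀ) * U + L₀ k * (U₀ᵀ * (U - U₀ * signAlign θ θ₀)) := by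
      rw [Matrix.sub_mul, Matrix.mul_sub U₀ᵀ, ← Matrix.mul_assoc U₀ᵀ, hF₀, Matrix.one_mul,
        Matrix.mul_assoc (L k), hF, Matrix.mul_one, Matrix.mul_sub, Matrix.mul_assoc]
      abel
    change ‖L k - L₀ k * signAlign θ θ₀‖ ≤ _
    rw [e]
    have n1 : ‖(L k * Uᵀ - L₀ k * U₀ᵀ) * U‖ ≤ δ * Real.sqrt r := by
      refine (Matrix.frobenius_norm_mul _ _).trans ?_
      rw [frobenius_norm_of_orthonormal hF]
      gcongr; exact hE' k
    have n2 : ‖L₀ k * (U₀ᵀ * (U - U₀ * signAlign θ θ₀))‖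
        ≤ Real.sqrt r * b * (Real.sqrt r * (C * δ)) := by
      refine (Matrix.frobenius_norm_mul _ _).trans ?_
      gcongr
      · exact nL₀ k
      · refine (Matrix.frobenius_norm_mul _ _).trans ?_
        rw [Matrix.frobenius_norm_transpose, frobenius_norm_of_orthonormal hF₀]
        gcongr
    refine (norm_add_le _ _).trans ?_
    linarith

lemma sqrt_add_le_rateL (hN : 0 < N) (hT : 0 < T) :
    Real.sqrt (N + T) ≤ Real.sqrt 2 * ((rateL N T)⁻¹ * (Real.sqrt N * Real.sqrt T)) := by
  have sN : 0 < Real.sqrt N := Real.sqrt_pos.2 (by exact_mod_cast hN)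
  have sT : 0 < Real.sqrt T := Real.sqrt_pos.2 (by exact_mod_cast hT)
  have e : (rateL N T)⁻¹ * (Real.sqrt N * Real.sqrt T) = max (Real.sqrt N) (Real.sqrt T) := by
    rw [rateL, ← min_mul_max (Real.sqrt N), inv_mul_cancel_left₀ (lt_min sN sT).ne']
  rw [e]
  refine Real.sqrt_le_iff.2 ⟨by positivity, ?_⟩
  rw [mul_pow, Real.sq_sqrt (by norm_num)]
  have h1 : (N : ℝ) ≤ max (Real.sqrt N) (Real.sqrt T) ^ 2 := by
    rw [← Real.sq_sqrt (Nat.cast_nonneg N)]; gcongr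
    rw [Real.sq_sqrt (Nat.cast_nonneg N)]; exact le_max_left _ _
  have h2 : (T : ℝ) ≤ max (Real.sqrt N) (Real.sqrt T) ^ 2 := by
    rw [← Real.sq_sqrt (Nat.cast_nonneg T)]; gcongr
    rw [Real.sq_sqrt (Nat.cast_nonneg T)]; exact le_max_right _ _
  linarith

variable {Ω : Type*} [MeasurableSpace Ω] {P : Measure Ω} [IsProbabilityMeasure P]

/-- The common components are estimated at rate `M / L_NT`, up to an event of probability `O(1/M)`,
by any parameter that does not increase the objective. -/
theorem measure_commonError_le (hN : 0 < N) (hT : 0 < T) {w τ : Fin K → ℝ}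
    (hτ : ∀ k, 0 < τ k ∧ τ k < 1) {wmin : ℝ} (hwmin0 : 0 < wmin) (hwmin : ∀ k, wmin ≤ w k)
    (hK : 0 < K) {X : Fin N → Fin T → Ω → ℝ} (hX : ∀ i t, Measurable (X i t))
    {θ₀ : Params K r N T}
    (hind : ∀ k, iIndepFun (fun (p : Fin N × Fin T) ω => X p.1 p.2 ω - θ₀.common k p.1 p.2) P)
    {a B : ℝ} (ha : 0 < a) (hgrowth : ∀ k i t d, |d| ≤ B →
      a * d ^ 2 ≤ ∫ y, checkInc (τ k) y d ∂(P.map fun ω => X i t ω - θ₀.common k i t))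
    {M : ℝ} (hM : 0 < M) :
    P {ω | ∃ θ : Params K r N T, (∀ k i t, |commonError θ θ₀ k i t| ≤ B) ∧
        objective w τ (fun i t => X i t ω) θ ≤ objective w τ (fun i t => X i t ω) θ₀ ∧
        (M * (rateL N T)⁻¹ * (Real.sqrt N * Real.sqrt T)) ^ 2 < ∑ k, ‖commonError θ θ₀ k‖ ^ 2}
      ≤ ENNReal.ofReal
        (K * (156 * Real.sqrt (2 * r) * Real.sqrt 2 * (∑ k, w k) / (wmin * a * M))) := by
  have sN : 0 < Real.sqrt N := Real.sqrt_pos.2 (by exact_mod_cast hN)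
  have sT : 0 < Real.sqrt T := Real.sqrt_pos.2 (by exact_mod_cast hT)
  have hL : 0 < (rateL N T)⁻¹ := inv_pos.2 (lt_min sN sT)
  have hw : ∀ k, 0 < w k := fun k => hwmin0.trans_le (hwmin k)
  have hW : 0 < ∑ k, w k :=
    Finset.sum_pos (fun k _ => hw k) ⟨⟨0, hK⟩, Finset.mem_univ _⟩
  have hsq := sqrt_add_le_rateL hN hT
  obtain ⟨l, hl⟩ : ∃ l, l = (rateL N T)⁻¹ * (Real.sqrt N * Real.sqrt T) := ⟨_, rfl⟩
  have hl0 : 0 < l := by rw [hl]; positivity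
  rw [mul_assoc M, ← hl]
  rw [← hl] at hsq
  -- Equality in the condition of `sum_norm_commonError_le` at radius `ϱ = M * l`. The tail bound is
  -- of order `ϱ * l / η`, that is `1 / M`.
  obtain ⟨η, hη⟩ : ∃ η, η = wmin * a * (M * l) ^ 2 / ∑ k, w k := ⟨_, rfl⟩
  have hη0 : 0 < η := by rw [hη]; positivity
  have hU : ∀ k (p : Fin N × Fin T), Measurable fun ω => X p.1 p.2 ω - θ₀.common k p.1 p.2 :=
    fun k p => (hX _ _).sub_const _
  let E : Fin K → Set Ω := fun k => {ω | ∃ d ∈ lowRankBall N T r (M * l),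
    η ≤ ∑ p, (∫ y, checkInc (τ k) y (d p) ∂(P.map fun ω => X p.1 p.2 ω - θ₀.common k p.1 p.2)
        - checkInc (τ k) (X p.1 p.2 ω - θ₀.common k p.1 p.2) (d p))}
  have hE : ∀ k, P (E k) ≤ ENNReal.ofReal
      (156 * Real.sqrt (2 * r) * Real.sqrt 2 * (∑ k, w k) / (wmin * a * M)) := fun k => by
    refine (measure_lowRank_deviation_le hN hT r (hτ k).1 (hτ k).2 (hU k) (hind k)
      (mul_pos hM hl0).le hη0).trans (ENNReal.ofReal_le_ofReal ?_)
    calc _ ≤ 156 * Real.sqrt (2 * r) * (M * l) * (Real.sqrt 2 * l) / η := by gcongr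
      _ = _ := by rw [hη]; field_simp
  refine (measure_mono (t := ⋃ k, E k) ?_).trans ?_
  · rintro ω ⟨θ, hB, hobj, hlt⟩
    by_contra hcon
    simp only [Set.mem_iUnion, not_exists] at hcon
    refine absurd hlt (not_lt.2 (sum_norm_commonError_le hN hT hw hB ha.le hwmin
      (m := fun k p d => ∫ y, checkInc (τ k) y d
        ∂(P.map fun ω => X p.1 p.2 ω - θ₀.common k p.1 p.2))
      (fun k p d => hgrowth k p.1 p.2 d) (mul_pos hM hl0) hobj (η := η) ?_ ?_))
    · rw [hη]; field_simp; exact le_refl _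
    · intro k d hd
      by_contra hge
      exact hcon k ⟨d, hd, not_lt.1 hge⟩
  · refine (measure_iUnion_le _).trans ?_
    rw [tsum_fintype]
    refine (Finset.sum_le_sum fun k _ => hE k).trans ?_
    rw [Finset.sum_const, Finset.card_univ, Fintype.card_fin, nsmul_eq_mul,
      ENNReal.ofReal_mul (Nat.cast_nonneg K), ENNReal.ofReal_natCast]

lemma tendsto_rateL : Tendsto (fun p : ℕ × ℕ => rateL p.1 p.2) atTop atTop := by
  refine tendsto_atTop.2 fun b => ?_
  have h : Tendsto (fun n : ℕ => Real.sqrt n) atTop atTop :=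
    Real.tendsto_sqrt_atTop.comp tendsto_natCast_atTop_atTop
  rw [← prod_atTop_atTop_eq]
  filter_upwards [(tendsto_fst.eventually (tendsto_atTop.1 h b)),
    (tendsto_snd.eventually (tendsto_atTop.1 h b))] with p h1 h2
  exact le_min h1 h2

lemma exists_abs_le_of_isCompact {S : Set (Fin r → ℝ)} (hS : IsCompact S) :
    ∃ b, 0 ≤ b ∧ ∀ v ∈ S, ∀ j, |v j| ≤ b := by
  obtain ⟨b, hb⟩ := hS.isBounded.exists_norm_le
  exact ⟨max b 0, le_max_right _ _, fun v hv j =>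
    ((norm_le_pi_norm v j).trans (hb v hv)).trans (le_max_left _ _)⟩

lemma abs_common_le {θ : Params K r N T} {b f : ℝ} (hb : 0 ≤ b)
    (hL : ∀ k i j, |θ.loading k i j| ≤ b) (hF : ∀ t j, |θ.factor t j| ≤ f) (k : Fin K) (i : Fin N)
    (t : Fin T) : |θ.common k i t| ≤ r * (b * f) := by
  rw [Params.common, dotProduct]
  refine (Finset.abs_sum_le_sum_abs _ _).trans ?_
  calc _ ≤ ∑ _j : Fin r, b * f := Finset.sum_le_sum fun j _ => by
        rw [abs_mul]; exact mul_le_mul (hL k i j) (hF t j) (abs_nonneg _) hb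
    _ = _ := by simp

lemma exists_gap {ν : Fin r → ℝ} (hνanti : StrictAnti ν) (hνpos : ∀ j, 0 < ν j) :
    ∃ g > 0, (∀ j, g ≤ ν j) ∧ ∀ i j, i < j → ν j + g ≤ ν i := by
  have h1 : ∀ᶠ g in 𝓝[>] (0 : ℝ), ∀ j, g ≤ ν j := eventually_all.2 fun j =>
    nhdsWithin_le_nhds (eventually_le_nhds (hνpos j))
  have h2 : ∀ᶠ g in 𝓝[>] (0 : ℝ), ∀ i j, i < j → ν j + g ≤ ν i :=
    eventually_all.2 fun i => eventually_all.2 fun j => eventually_imp_distrib_left.2 fun hij => by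
      filter_upwards [nhdsWithin_le_nhds (eventually_le_nhds (sub_pos.2 (hνanti hij)))] with g hg
      linarith
  obtain ⟨g, ⟨h1, h2⟩, h3⟩ := ((h1.and h2).and self_mem_nhdsWithin).exists
  exact ⟨g, h3, h1, h2⟩

end Rates

end DAFM

/-! ### The main theorem. -/

theorem theorem1
    {Ω : Type*} [MeasurableSpace Ω] (P : Measure Ω) [IsProbabilityMeasure P]
    {K r : ℕ} (kstar : Fin K)
    -- quantile levels and weights
    (τ w : Fin K → ℝ) (hτ : ∀ k, 0 < τ k ∧ τ k < 1) (hw : ∀ k, 0 < w k)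
    -- the data, the true parameters (non-random) and the densities, for every sample size
    (X : (N T : ℕ) → Fin N → Fin T → Ω → ℝ)
    (hX : ∀ N T i t, Measurable (X N T i t))
    (θ₀ : (N T : ℕ) → Params K r N T)
    (h : (N T : ℕ) → Fin N → Fin T → ℝ → ℝ)
    -- the quantile factor structure
    (hmodel : ∀ᶠ p : ℕ × ℕ in atTop, ∀ k i t,
      quantile (P.map (X p.1 p.2 i t)) (τ k) = (θ₀ p.1 p.2).common k i t)
    -- (a) the parameter sets are compact
    (𝒜 ℱ : Set (Fin r → ℝ)) (h𝒜 : IsCompact 𝒜) (hℱ : IsCompact ℱ)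
    -- (b) the true parameter is in the parameter space; distinct positive limiting eigenvalues
    (hθ₀ : ∀ᶠ p : ℕ × ℕ in atTop, θ₀ p.1 p.2 ∈ paramSpace 𝒜 ℱ kstar p.1 p.2)
    (ν : Fin r → ℝ) (hνanti : StrictAnti ν) (hνpos : ∀ j, 0 < ν j)
    (hν : ∀ j, Tendsto (fun p : ℕ × ℕ => gram ((θ₀ p.1 p.2).loading kstar) j j) atTop (𝓝 (ν j)))
    -- (c) densities, bounded below on compact sets uniformly in i and t
    (hh_meas : ∀ N T i t, Measurable (h N T i t))
    (hh_nonneg : ∀ N T i t x, 0 ≤ h N T i t x)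
    (hh_density : ∀ᶠ p : ℕ × ℕ in atTop, ∀ i t,
      P.map (X p.1 p.2 i t) = volume.withDensity fun x => ENNReal.ofReal (h p.1 p.2 i t x))
    (hh_lower : ∀ C : Set ℝ, IsCompact C → ∃ c : ℝ, 0 < c ∧ ∀ᶠ p : ℕ × ℕ in atTop,
      ∀ i t, ∀ x ∈ C, c ≤ h p.1 p.2 i t x)
    -- (d) for each k the errors are independent across i and t
    (hindep : ∀ᶠ p : ℕ × ℕ in atTop, ∀ k,
      iIndepFun (fun (it : Fin p.1 × Fin p.2) ω =>
        X p.1 p.2 it.1 it.2 ω - (θ₀ p.1 p.2).common k it.1 it.2) P)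
    -- the estimator: a global minimizer of the objective over the parameter space
    (θhat : (N T : ℕ) → Ω → Params K r N T)
    (hθhat : ∀ᶠ p : ℕ × ℕ in atTop, ∀ᵐ ω ∂P,
      θhat p.1 p.2 ω ∈ paramSpace 𝒜 ℱ kstar p.1 p.2 ∧
      IsMinOn (objective w τ fun i t => X p.1 p.2 i t ω) (paramSpace 𝒜 ℱ kstar p.1 p.2)
        (θhat p.1 p.2 ω)) :
    IsBigOp P
      (fun N T ω => ‖(θhat N T ω).factor
        - (θ₀ N T).factor * signAlign (θhat N T ω) (θ₀ N T)‖ / Real.sqrt T)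
      (fun N T => (rateL N T)⁻¹) ∧
    ∀ k, IsBigOp P
      (fun N T ω => ‖(θhat N T ω).loading k
        - (θ₀ N T).loading k * signAlign (θhat N T ω) (θ₀ N T)‖ / Real.sqrt N)
      (fun N T => (rateL N T)⁻¹) := by
  have hK : 0 < K := kstar.pos
  obtain ⟨b, hb0, hb⟩ := exists_abs_le_of_isCompact h𝒜
  obtain ⟨f, hf0, hf⟩ := exists_abs_le_of_isCompact hℱ
  obtain ⟨g, hg0, hgν, hgap⟩ := exists_gap hνanti hνpos
  -- Half of `g`, because the Gram entries are only within `g / 4` of their limits.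
  obtain ⟨C, hC, δ₀, hδ₀, halign⟩ := exists_alignment_bound r hb0 (half_pos hg0)
  obtain ⟨B, hB⟩ : ∃ B : ℝ, B = r * (b * f) := ⟨_, rfl⟩
  -- Quantiles lie within `B` of `0` and errors of common components within `2 * B`, so densities
  -- matter only on this interval.
  obtain ⟨c, hc0, hc⟩ := hh_lower (Set.Icc (-(B + 2 * B)) (B + 2 * B)) isCompact_Icc
  obtain ⟨wmin, hwmin0, hwmin⟩ : ∃ wmin > 0, ∀ k, wmin ≤ w k := by
    have : Nonempty (Fin K) := ⟨kstar⟩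
    obtain ⟨k₀, hk₀⟩ := Finite.exists_min w
    exact ⟨w k₀, hw k₀, hk₀⟩
  have hbound : ∀ {N T : ℕ} {θ : Params K r N T}, θ ∈ paramSpace 𝒜 ℱ kstar N T →
      (∀ k i j, |θ.loading k i j| ≤ b) ∧ ∀ k i t, |θ.common k i t| ≤ B := fun hθ =>
    ⟨fun k i j => hb _ (hθ.1 k i) j, fun k i t => hB ▸ abs_common_le hb0
      (fun k i j => hb _ (hθ.1 k i) j) (fun t j => hf _ (hθ.2.1 t) j) k i t⟩
  have hpos : ∀ᶠ p : ℕ × ℕ in atTop, 0 < p.1 ∧ 0 < p.2 := by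
    filter_upwards [eventually_ge_atTop ((1, 1) : ℕ × ℕ)] with p hp
    exact ⟨hp.1, hp.2⟩
  have hνev : ∀ᶠ p : ℕ × ℕ in atTop, ∀ j,
      |gram ((θ₀ p.1 p.2).loading kstar) j j - ν j| < g / 4 :=
    eventually_all.2 fun j => by
      simpa [Real.dist_eq] using Metric.tendsto_nhds.1 (hν j) (g / 4) (by positivity)
  -- One event serves all conclusions at once. It lies in the union of the deviation event and the
  -- null set where minimality fails, so no measurability of the estimator is needed.
  have key : ∀ ε : ℝ, 0 < ε → ∃ M : ℝ, 0 < M ∧ ∀ᶠ p : ℕ × ℕ in atTop,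
      P {ω | ¬ (‖(θhat p.1 p.2 ω).factor
          - (θ₀ p.1 p.2).factor * signAlign (θhat p.1 p.2 ω) (θ₀ p.1 p.2)‖ / Real.sqrt p.2
            ≤ M * (rateL p.1 p.2)⁻¹ ∧
        ∀ k, ‖(θhat p.1 p.2 ω).loading k
          - (θ₀ p.1 p.2).loading k * signAlign (θhat p.1 p.2 ω) (θ₀ p.1 p.2)‖ / Real.sqrt p.1
            ≤ M * (rateL p.1 p.2)⁻¹)} ≤ ENNReal.ofReal ε := by
    intro ε hε
    obtain ⟨A, hA⟩ : ∃ A : ℝ, A = K * (156 * Real.sqrt (2 * r) * Real.sqrt 2 * ∑ k, w k)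
        / (wmin * (c / 4)) := ⟨_, rfl⟩
    have hA0 : 0 ≤ A := by
      have : 0 ≤ ∑ k, w k := Finset.sum_nonneg fun k _ => (hw k).le
      rw [hA]; positivity
    -- The failure probability is at most `A / M`, and this choice makes it at most `ε`.
    obtain ⟨M, hM⟩ : ∃ M : ℝ, M = A / ε + 1 := ⟨_, rfl⟩
    have hM0 : 0 < M := by rw [hM]; positivity
    refine ⟨C * M, by positivity, ?_⟩
    filter_upwards [hmodel, hθ₀, hh_density, hc, hindep, hθhat, hpos, hνev,
      tendsto_rateL.eventually_ge_atTop (M / δ₀)]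
      with p hmodel hθ₀ hdens hc hindep hθhat hpos hνev hrate
    obtain ⟨N, T⟩ := p
    obtain ⟨hN, hT⟩ := hpos
    simp only at hmodel hθ₀ hdens hc hindep hθhat hN hT hνev hrate ⊢
    have hL : 0 < rateL N T :=
      lt_min (Real.sqrt_pos.2 (by exact_mod_cast hN)) (Real.sqrt_pos.2 (by exact_mod_cast hT))
    have hδ : M * (rateL N T)⁻¹ ≤ δ₀ := by
      rw [← div_eq_mul_inv, div_le_iff₀ hL]
      rwa [div_le_iff₀ hδ₀, mul_comm] at hrate
    obtain ⟨hb₀, hB₀⟩ := hbound hθ₀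
    have hprob := measure_commonError_le (P := P) hN hT hτ hwmin0 hwmin hK (hX N T) hindep
      (show 0 < c / 4 by positivity) (B := 2 * B)
      (fun k i t d hd => sq_le_integral_checkInc_error (hτ k).1 (hτ k).2 (hX N T i t) (hdens i t)
        (hmodel k i t) hc0.le (R := B + 2 * B) (by linarith [hB₀ k i t]) (hc i t) hd) hM0
    have hnull := ae_iff.1 hθhat
    refine (measure_mono ?_).trans ((measure_union_le _ _).trans
      ((add_le_add hprob hnull.le).trans ?_))
    · intro ω hω
      by_contra hcon
      rw [Set.mem_union, not_or] at hcon
      obtain ⟨h1, h2⟩ := hcon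
      simp only [Set.mem_ofPred_eq, not_not] at h2
      obtain ⟨hmem, hmin⟩ := h2
      obtain ⟨hb₁, hB₁⟩ := hbound hmem
      have hsum : ∑ k, ‖commonError (θhat N T ω) (θ₀ N T) k‖ ^ 2
          ≤ (M * (rateL N T)⁻¹ * (Real.sqrt N * Real.sqrt T)) ^ 2 := by
        by_contra hlt
        refine h1 ⟨θhat N T ω, fun k i t => ?_, hmin hθ₀, not_le.1 hlt⟩
        rw [commonError_apply]
        linarith [abs_sub ((θhat N T ω).common k i t) ((θ₀ N T).common k i t), hB₀ k i t,
          hB₁ k i t]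
      have hν' := fun j => abs_lt.1 (hνev j)
      refine hω ?_
      simp only [mul_assoc C]
      refine halign hN hT hmem.2.2.1 hθ₀.2.2.1 hmem.2.2.2.1 hmem.2.2.2.2 hθ₀.2.2.2.1
        (fun j => ?_) (fun i j hij => ?_) hb₁ hb₀ (fun k => ?_) hδ
      · linarith [hν' j, hgν j]
      · linarith [hν' i, hν' j, hgap i j hij]
      · refine le_of_sq_le_sq (le_trans ?_ hsum) (by positivity)
        exact Finset.single_le_sum (f := fun k => ‖commonError (θhat N T ω) (θ₀ N T) k‖ ^ 2)
          (fun _ _ => sq_nonneg _) (Finset.mem_univ k)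
    · rw [add_zero]
      refine ENNReal.ofReal_le_ofReal ?_
      have e : K * (156 * Real.sqrt (2 * r) * Real.sqrt 2 * (∑ k, w k) / (wmin * (c / 4) * M))
          = A / M := by rw [hA]; field_simp
      rw [e, div_le_iff₀ hM0, hM, mul_add, mul_div_cancel₀ _ hε.ne']
      linarith
  refine ⟨fun ε hε => ?_, fun k ε hε => ?_⟩
  · obtain ⟨M, hM, h⟩ := key ε hε
    refine ⟨M, hM, h.mono fun p hp => (measure_mono fun ω hω hgood => ?_).trans hp⟩
    rw [Set.mem_ofPred_eq, abs_of_nonneg (by positivity)] at hω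
    exact absurd hgood.1 (not_le.2 hω)
  · obtain ⟨M, hM, h⟩ := key ε hε
    refine ⟨M, hM, h.mono fun p hp => (measure_mono fun ω hω hgood => ?_).trans hp⟩
    rw [Set.mem_ofPred_eq, abs_of_nonneg (by positivity)] at hω
    exact absurd (hgood.2 k) (not_le.2 hω)
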